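/- **Setting.** Let $d\ge 1$. A sequence of i.i.d. $\mathrm{Bern}(1/2)$ bits $M_1,M_2,\dots$ is sent by $d$ transmitters. A *multi-rate sequential (MRS) code* consists of common randomness $Q$ (independent of the message and of the channels, known to senders and receivers), measurable encoders giving the bit $X_{k,n}=\mathrm{Enc}(Q,\{M_i\},k,n)\in\{0,1\}$ sent by Transmitter $k$ at time $n$, and a measurable decoder $\widetilde M_m=\mathrm{Dec}(Q,Y_1^N,m)$, where $Y_n\in\{0,1,e\}^d$ is the vector of symbols received at time $n$. A receiver with capacity vector $\mathbf c\in[0,1]^d$ receives each $X_{k,n}$ through an erasure channel: independently over $k$ and $n$, the symbol is replaced by $e$ with probability $1-c_k$. A pair $(\rho,\mathbf c)$ is *$\epsilon$-admissible* by the code if there is $N_0$ such that, for the receiver with capacities $\mathbf c$, $\mathbb P\{M_m\ne\widetilde M_m(Q,Y_1^N)\}\le\epsilon$ for all $N\ge N_0$ and all $1\le m\le N(\rho-\epsilon)$. **Superposition codes.** A *superposition code* is given by a block size $K\ge1$ and functions $g_k:[0,\infty)\to[0,\infty)$, $k=1,\dots,d$, each bounded, decreasing, left continuous, with $\int_0^\infty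 g_k=1$. For all $k,i$ independently, Transmitter $k$ samples $A_{k,i}\ge0$ with distribution function $F_k(\alpha)=\int_0^\alpha g_k(x)\,dx-\alpha g_k(\alpha)$ (that is, $\mathbb P\{A_{k,i}<\alpha\}=F_k(\alpha)$), and at time $i$ it sends a uniformly random $\mathbb F_2$-linear combination of the bits of the block $B_j=M_{(j-1)K+1}^{jK}$ with $j=\lceil iA_{k,i}/K\rceil$. The numbers $A_{k,i}$ and the coefficients form $Q$; any decoder may be used. **One-or-all on-off multicast network.** There are $d$ transmitters and receivers $0,1,\dots,d$. Transmitter $k$ broadcasts at rate $w_k\ge0$ (bit/s) to Receivers $0$ and $k$. Fix a number $s>0$ of channel uses per second with $w_k\le s$ for all $k$, and replace a link of rate $w_k$ by an erasure channel of capacity $w_k/s$: Receiver $0$ has capacity vector $\mathbf c_0=(w_1/s,\dots,w_d/s)$, and Receiver $k$ has capacity vector $\mathbf c_k$ with $k$-th entry $w_k/s$ and all other entries $0$. A tuple of nonnegative rates $(r_0,r_1,\dots,r_d)$ is *achievable* if for every $\epsilon>0$ there is one MRS code by which all the pairs $(r_k/s,\mathbf c_k)$, $k=0,\dots,d$, are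 $\epsilon$-admissible; it is *achievable by superposition codes* if for every $\epsilon>0$ this code can be taken to be a superposition code. **Theorem.** The set of achievable tuples $(r_0,\dots,r_d)$ is exactly the set of those satisfying $$r_0\ge0,\qquad 0\le r_k\le w_k\ \text{ for }k=1,\dots,d,$$ $$\text{and either } r_0\le\max_{1\le k\le d}w_k\quad\text{or}\quad\sum_{k=1}^d\frac{w_k-r_k}{r_0-r_k}\ge1 .$$ Moreover superposition codes are optimal: the set of tuples achievable by superposition codes is the same set. -/

import Mathlib

open MeasureTheory ProbabilityTheory

noncomputable section

namespace MultiRate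

/-- The law of a sequence of independent fair bits `M_1, M_2, …`.
The bit `M_{m+1}` is stored at index `m`. -/
def messageLaw : Measure (ℕ → Bool) :=
  Measure.infinitePi fun _ : ℕ => bernoulliMeasure true false ⟨1 / 2, by norm_num, by norm_num⟩

instance : IsProbabilityMeasure messageLaw := by
  unfold messageLaw; infer_instance

/-- The law of the erasure pattern of a receiver with capacity vector `c`. The entry at `(n, k)` says
whether the symbol sent by Transmitter `k` at time `n + 1` is erased. The entries are independent,
and a symbol of Transmitter `k` is erased with probability `1 - c k`. -/
def erasureLaw {d : ℕ} (c : Fin d → unitInterval) : Measure (ℕ × Fin d → Bool) :=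
  Measure.infinitePi fun p : ℕ × Fin d => bernoulliMeasure true false (unitInterval.symm (c p.2))

instance {d : ℕ} (c : Fin d → unitInterval) : IsProbabilityMeasure (erasureLaw c) := by
  unfold erasureLaw; infer_instance

/-- A multi-rate sequential code for `d` transmitters. `Q` is the common randomness of sender and
receivers, with its law. `enc q M k n` is the symbol sent by Transmitter `k` at time `n + 1`, and
`dec q N y m` is the estimate of the message bit with index `m` from the first `N` received
(vector) symbols `y`, where `none` stands for an erased symbol. -/
structure MRSCode (d : ℕ) where
  Q : Type
  [measurableSpace : MeasurableSpace Q]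
  law : Measure Q
  [isProbabilityMeasure : IsProbabilityMeasure law]
  enc : Q → (ℕ → Bool) → Fin d → ℕ → Bool
  dec : Q → (N : ℕ) → (Fin N → Fin d → Option Bool) → ℕ → Bool
  measurable_enc : ∀ k n, Measurable fun p : Q × (ℕ → Bool) => enc p.1 p.2 k n
  measurable_dec : ∀ N y m, Measurable fun q => dec q N y m

attribute [instance] MRSCode.measurableSpace MRSCode.isProbabilityMeasure

/-- The first `N` received symbols, when `x` is sent and the erasure pattern is `e`. -/
def received {d : ℕ} (x : Fin d → ℕ → Bool) (e : ℕ × Fin d → Bool) (N : ℕ) :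
    Fin N → Fin d → Option Bool :=
  fun n k => if e (n, k) then none else some (x k n)

/-- The probability that the receiver with capacity vector `c` decodes the message bit with index
`m` wrongly from the first `N` received symbols. Common randomness, message and erasures are
independent. -/
def MRSCode.errorProb {d : ℕ} (C : MRSCode d) (c : Fin d → unitInterval) (N m : ℕ) : ℝ :=
  (C.law.prod (messageLaw.prod (erasureLaw c))).real
    {ω | ω.2.1 m ≠ C.dec ω.1 N (received (C.enc ω.1 ω.2.1) ω.2.2 N) m}

/-- The rate-capacity pair `(r, c)` is `ε`-admissible by the code `C`: for all large `N`, each of the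
bits `M_1, …, M_{⌊N(r - ε)⌋}` is decoded from the first `N` received symbols with error
probability at most `ε`. -/
def MRSCode.Admissible {d : ℕ} (C : MRSCode d) (ε r : ℝ) (c : Fin d → unitInterval) : Prop :=
  ∃ N₀ : ℕ, ∀ N : ℕ, N₀ ≤ N → ∀ m : ℕ, (m : ℝ) + 1 ≤ N * (r - ε) → C.errorProb c N m ≤ ε

/-- The cumulative distribution function `F_A(α) = ∫₀^α g(x) dx - α g(α)` of a parameter `g`. -/
def parameterCDF (g : ℝ → ℝ) (α : ℝ) : ℝ := (∫ x in (0 : ℝ)..α, g x) - α * g α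

/-- The data of a superposition code for `d` transmitters: the block size `K` and the parameter
`g = (g_1, …, g_d)`, of which only the values on `[0, ∞)` matter. As `g_k` is left continuous, so is
`F_A`; hence it is `α ↦ P(A < α)` for the random variable `A`, whose law `lawA k` it determines. -/
structure SuperpositionData (d : ℕ) where
  K : ℕ
  K_pos : 0 < K
  g : Fin d → ℝ → ℝ
  g_nonneg : ∀ k, ∀ α, 0 ≤ α → 0 ≤ g k α
  g_bounded : ∀ k, ∃ B, ∀ α, 0 ≤ α → g k α ≤ B
  g_antitone : ∀ k, AntitoneOn (g k) (Set.Ici 0)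
  g_leftCont : ∀ k, ∀ α, 0 ≤ α → ContinuousWithinAt (g k) (Set.Icc 0 α) α
  g_integral : ∀ k, ∫⁻ α in Set.Ici (0 : ℝ), ENNReal.ofReal (g k α) = 1
  lawA : Fin d → Measure ℝ
  lawA_isProbabilityMeasure : ∀ k, IsProbabilityMeasure (lawA k)
  lawA_Iio : ∀ k, ∀ α, 0 ≤ α → (lawA k).real (Set.Iio α) = parameterCDF (g k) α

namespace SuperpositionData

variable {d : ℕ}

instance (S : SuperpositionData d) (k : Fin d) : IsProbabilityMeasure (S.lawA k) :=
  S.lawA_isProbabilityMeasure k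

/-- The common randomness: for each time index `n` and each transmitter `k`, the random variable
`A_{k,n+1}` and the coefficient vector of a random linear projection of a block of `K` bits. -/
abbrev Randomness (S : SuperpositionData d) : Type := ℕ × Fin d → ℝ × (Fin S.K → Bool)

/-- All the entries are independent, `A_{k,n}` has the law `lawA k` and the coefficient vectors are
uniform on `{0,1}^K`. -/
def randomnessLaw (S : SuperpositionData d) : Measure S.Randomness :=
  Measure.infinitePi fun p : ℕ × Fin d =>
    (S.lawA p.2).prod
      (Measure.pi fun _ : Fin S.K =>
        bernoulliMeasure true false ⟨1 / 2, by norm_num, by norm_num⟩)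

instance (S : SuperpositionData d) : IsProbabilityMeasure S.randomnessLaw := by
  unfold randomnessLaw; infer_instance

/-- The index, counted from `0`, of the block used by Transmitter `k` at time `i = n + 1`, that is
`⌈i A_{k,i} / K⌉ - 1`. (The event `A_{k,i} ≤ 0` has probability zero.) -/
def blockIndex (S : SuperpositionData d) (q : S.Randomness) (k : Fin d) (n : ℕ) : ℕ :=
  ⌈((n : ℝ) + 1) * (q (n, k)).1 / S.K⌉₊ - 1

/-- The symbol sent by Transmitter `k` at time `n + 1`: the inner product modulo `2` of the
coefficient vector and the chosen block of `K` consecutive message bits. -/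
def encode (S : SuperpositionData d) (q : S.Randomness) (M : ℕ → Bool) (k : Fin d) (n : ℕ) : Bool :=
  Nat.bodd (∑ j : Fin S.K, ((q (n, k)).2 j && M (S.blockIndex q k n * S.K + j)).toNat)

theorem measurable_blockIndex (S : SuperpositionData d) (k : Fin d) (n : ℕ) :
    Measurable fun q : S.Randomness => S.blockIndex q k n := by
  have h : Measurable fun q : S.Randomness => ((n : ℝ) + 1) * (q (n, k)).1 / S.K := by fun_prop
  exact (measurable_from_nat (f := fun a : ℕ => a - 1)).comp (Nat.measurable_ceil.comp h)

theorem measurable_encode (S : SuperpositionData d) (k : Fin d) (n : ℕ) :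
    Measurable fun p : S.Randomness × (ℕ → Bool) => S.encode p.1 p.2 k n := by
  refine (measurable_from_nat (f := Nat.bodd)).comp (Finset.measurable_sum _ fun j _ => ?_)
  have h1 : Measurable fun p : S.Randomness × (ℕ → Bool) => (p.1 (n, k)).2 j := by fun_prop
  have h2 : Measurable fun x : ℕ × (ℕ → Bool) => x.2 (x.1 * S.K + j) :=
    measurable_from_prod_countable_right fun b =>
      measurable_pi_apply (X := fun _ : ℕ => Bool) (b * S.K + (j : ℕ))
  have h3 : Measurable fun p : S.Randomness × (ℕ → Bool) =>
      p.2 (S.blockIndex p.1 k n * S.K + j) :=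
    h2.comp (((S.measurable_blockIndex k n).comp measurable_fst).prodMk measurable_snd)
  exact (measurable_of_countable fun x : Bool × Bool => (x.1 && x.2).toNat).comp (h1.prodMk h3)

/-- The superposition code with the data `S` and a decoder `dec`. -/
def code (S : SuperpositionData d)
    (dec : S.Randomness → (N : ℕ) → (Fin N → Fin d → Option Bool) → ℕ → Bool)
    (hdec : ∀ N y m, Measurable fun q => dec q N y m) : MRSCode d where
  Q := S.Randomness
  law := S.randomnessLaw
  enc := S.encode
  dec := dec
  measurable_enc := S.measurable_encode
  measurable_dec := hdec

end SuperpositionData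

/-- A code is a superposition code. -/
def MRSCode.IsSuperposition {d : ℕ} (C : MRSCode d) : Prop :=
  ∃ (S : SuperpositionData d)
    (dec : S.Randomness → (N : ℕ) → (Fin N → Fin d → Option Bool) → ℕ → Bool)
    (hdec : ∀ N y m, Measurable fun q => dec q N y m), C = S.code dec hdec

/-- The capacity vector of Receiver `0`, which hears every transmitter. If a link carries `w k` bits
per second and there are `s ≥ w k` channel uses per second, it is an erasure channel of
capacity `w k / s`. -/
def capacityAll {d : ℕ} (w : Fin d → ℝ) (s : ℝ) : Fin d → unitInterval :=
  fun k => Set.projIcc (0 : ℝ) 1 zero_le_one (w k / s)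

/-- The capacity vector of Receiver `k`, which hears Transmitter `k` only. -/
def capacityOne {d : ℕ} (w : Fin d → ℝ) (s : ℝ) (k : Fin d) : Fin d → unitInterval :=
  fun j => if j = k then capacityAll w s k else 0

/-- The code `C` satisfies all the rate requirements of the one-or-all network up to `ε`: Receiver `0`
decodes at rate `r₀` and Receiver `k` at rate `r k` (bits per second, with `s` channel uses per
second). -/
def MRSCode.Serves {d : ℕ} (C : MRSCode d) (ε : ℝ) (w : Fin d → ℝ) (s r₀ : ℝ) (r : Fin d → ℝ) :
    Prop :=
  C.Admissible ε (r₀ / s) (capacityAll w s) ∧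
    ∀ k, C.Admissible ε (r k / s) (capacityOne w s k)

/-- The achievable region of the one-or-all on-off multicast network with link rates `w`: the
nonnegative rates `(r₀, r)` that, for each `ε > 0`, some code serves up to `ε`. -/
def achievableRegion {d : ℕ} (w : Fin d → ℝ) (s : ℝ) : Set (ℝ × (Fin d → ℝ)) :=
  {p | 0 ≤ p.1 ∧ (∀ k, 0 ≤ p.2 k) ∧ ∀ ε : ℝ, 0 < ε → ∃ C : MRSCode d, C.Serves ε w s p.1 p.2}

/-- The region achievable by superposition codes. -/
def superpositionRegion {d : ℕ} (w : Fin d → ℝ) (s : ℝ) : Set (ℝ × (Fin d → ℝ)) :=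
  {p | 0 ≤ p.1 ∧ (∀ k, 0 ≤ p.2 k) ∧
    ∀ ε : ℝ, 0 < ε → ∃ C : MRSCode d, C.IsSuperposition ∧ C.Serves ε w s p.1 p.2}

end MultiRate

end

/-!
The region is sandwiched: it is contained in the region achievable by superposition codes, which is
trivially contained in the achievable region, which is contained in the region by a converse.
Throughout, `c k = w k / s` are the capacities, and `ρ₀ = r₀ / s`, `ρ k = r k / s` the rates per
channel use.

**Converse.** Everything is conditioned on the common randomness and the erasure pattern, so that
only entropies on a finite sample space are needed; Receiver `k` is realized by masking the erasure
pattern of Receiver `0`. Reveal the symbols of Receiver `0` one time step after the other, and the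
message bits as soon as Receiver `0` has decoded them. At time `n` the first `ρ₀ n` bits are known,
so the `ρ₀ N` bits decoded up to time `N` are paid for by the fresh information
`S_k(N) = ∑_{n<N} H(Y_k(n) | Y_k(0), …, Y_k(n-1), M_1, …, M_{ρ₀ n})` of the transmitters
(`entropy_interleaved_le`). Put `lam = ρ k / ρ₀`. From the time `lam N` on, at least the first
`ρ k N` bits are known. As conditioning reduces entropy, the symbols between the times `lam N` and
`N` contribute at most `H(Y_k(0), …, Y_k(N-1) | M_1, …, M_{ρ k N})`, which is about `(c k - ρ k) N`
because Receiver `k` decodes these bits from its received symbols. Hence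
`S_k(N) ≤ S_k(lam N) + (c k - ρ k) N` (`freshInfo_le`), and summing the geometric series gives
`S_k(N) ≤ (c k - ρ k) N / (1 - lam)` (`MRSCode.exists_fresh_le`). The sum over `k` is the claimed
inequality `ρ₀ ≤ ∑ (c k - ρ k) ρ₀ / (ρ₀ - ρ k)`. The information-theoretic tools (conditioning reduces
entropy, Fano's inequality, the bound by the logarithm of the alphabet size) all come from one
inequality of Gibbs, `condEntropy_le_cross`. The Fano terms are affine in the error
probabilities, so averaging over common randomness and erasures involves error probabilities and
erasure counts only.

**Achievability.** Transmitter `k` draws one of two values, near `ρ k` and `ρ₀`, so that its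
parameter `g k` is a step function; the heights are chosen such that `c k * g k (ρ k) = 1` and
`∑ c k * g k ρ₀ ≥ 1` (`exists_atoms`). Shrinking the values slightly makes these products exceed `1`.
A block of `K` bits is then hit by more than `K` unerased random combinations in the mean. The
receiver chooses any block that agrees with the received combinations. An error
requires a nonzero vector that is annihilated by all of them. Either the number of combinations falls
below a threshold `T > K`, which is unlikely by a Chernoff bound, or one of fewer than `2 ^ K` vectors
is annihilated by more than `T` combinations, which has probability at most `2 ^ (K - T)`
(`SuperpositionData.errorProb_le_exp`). Both tend to `0` as `K → ∞`.
-/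

open MeasureTheory ProbabilityTheory

namespace MultiRate

/-! ### Shannon entropy on a finite weighted sample space -/

section Entropy

open Finset Real
open scoped Classical

variable {α β γ δ : Type*} [Fintype α]

/-- The weight of the level set of `f` through the outcome `a`. -/
noncomputable def levelMass (p : α → ℝ) (f : α → β) (a : α) : ℝ := ∑ b with f b = f a, p b

/-- The Shannon entropy, in nats, of the random variable `f` on the sample space `α` with weights
`p`, written as the expectation of `-log P(f = f a)`. -/
noncomputable def entropy (p : α → ℝ) (f : α → β) : ℝ := -∑ a, p a * log (levelMass p f a)

/-- The conditional entropy `H(f | W) = H(f, W) - H(W)`. -/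
noncomputable def condEntropy (p : α → ℝ) (f : α → β) (W : α → γ) : ℝ :=
  entropy p (fun a => (f a, W a)) - entropy p W

variable {p : α → ℝ}

lemma levelMass_pos (hp : ∀ a, 0 ≤ p a) (f : α → β) {a : α} (ha : p a ≠ 0) :
    0 < levelMass p f a :=
  sum_pos' (fun b _ => hp b) ⟨a, by simp, lt_of_le_of_ne (hp a) ha.symm⟩

/-- The entropy depends on a random variable only through its level sets. -/
lemma entropy_congr {f : α → β} {g : α → γ} (h : ∀ a b, f a = f b ↔ g a = g b) :
    entropy p f = entropy p g := by
  simp only [entropy, levelMass, h]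

lemma entropy_mono (hp : ∀ a, 0 ≤ p a) {f : α → β} {g : α → γ} (h : ∀ a b, g a = g b → f a = f b) :
    entropy p f ≤ entropy p g := by
  refine neg_le_neg (sum_le_sum fun a _ => ?_)
  by_cases ha : p a = 0
  · simp [ha]
  refine mul_le_mul_of_nonneg_left (log_le_log (levelMass_pos hp g ha) ?_) (hp a)
  exact sum_le_sum_of_subset_of_nonneg (fun b => by simpa using h b a) fun b _ _ => hp b

lemma entropy_eq_zero_of_const (hp1 : ∑ a, p a = 1) {f : α → β} (h : ∀ a b, f a = f b) :
    entropy p f = 0 := by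
  have : ∀ a, levelMass p f a = 1 := fun a => by simp [levelMass, h _ a, hp1]
  simp [entropy, this]

lemma condEntropy_congr {β' γ' : Type*} {f : α → β} {W : α → γ} {f' : α → β'} {W' : α → γ'}
    (h : ∀ a b, (f a = f b ∧ W a = W b) ↔ (f' a = f' b ∧ W' a = W' b))
    (hW : ∀ a b, W a = W b ↔ W' a = W' b) :
    condEntropy p f W = condEntropy p f' W' := by
  unfold condEntropy
  rw [entropy_congr hW, entropy_congr (g := fun a => (f' a, W' a)) (by simpa using h)]

lemma entropy_le_pair (hp : ∀ a, 0 ≤ p a) (f : α → β) (W : α → γ) :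
    entropy p W ≤ entropy p (fun a => (f a, W a)) :=
  entropy_mono hp fun _ _ h => congrArg Prod.snd h

lemma condEntropy_eq_zero {f : α → β} {W : α → γ} (h : ∀ a b, W a = W b → f a = f b) :
    condEntropy p f W = 0 :=
  sub_eq_zero.2 (entropy_congr fun a b => by simpa using h a b)

/-- **Gibbs' inequality** in conditional form: the conditional entropy of `f` given `W` is at most
the expected code length `-log κ(f | W)` of any conditional (sub)distribution `κ`. All other
entropy inequalities used below come from special choices of `κ`. -/
lemma condEntropy_le_cross [Fintype β] (hp : ∀ a, 0 ≤ p a) (f : α → β) (W : α → γ)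
    (κ : β → γ → ℝ) (hκ : ∀ v w, 0 ≤ κ v w) (hκ1 : ∀ w, ∑ v, κ v w ≤ 1)
    (hpos : ∀ a, p a ≠ 0 → 0 < κ (f a) (W a)) :
    condEntropy p f W ≤ -∑ a, p a * log (κ (f a) (W a)) := by
  set P := levelMass p W with hP
  set R := levelMass p (fun a => (f a, W a)) with hR
  have key : ∑ a, p a * (κ (f a) (W a) * P a / R a) ≤ ∑ a, p a := by
    have h1 : ∀ a, p a * (κ (f a) (W a) * P a / R a)
        = ∑ b, if W b = W a then p b * (p a * κ (f a) (W a) / R a) else 0 := by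
      intro a
      rw [← sum_filter, ← sum_mul]
      simp only [hP, levelMass]
      ring
    simp_rw [h1]
    rw [sum_comm]
    refine sum_le_sum fun b _ => ?_
    rw [← sum_filter, ← mul_sum]
    refine mul_le_of_le_one_right (hp b) ?_
    rw [← sum_fiberwise _ f]
    refine le_trans (sum_le_sum fun v _ => ?_) (hκ1 (W b))
    have h2 : ∀ a ∈ {a ∈ univ.filter (fun a => W b = W a) | f a = v},
        p a * κ (f a) (W a) / R a
          = κ v (W b) * (p a / ∑ a ∈ {a ∈ univ.filter (fun a => W b = W a) | f a = v}, p a) := by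
      intro a ha
      simp only [mem_filter, mem_univ, true_and] at ha
      have h3 : R a = ∑ a ∈ {a ∈ univ.filter (fun a => W b = W a) | f a = v}, p a := by
        rw [hR, levelMass, filter_filter]
        refine sum_congr ?_ fun _ _ => rfl
        ext c
        simp only [mem_filter, mem_univ, true_and, Prod.mk.injEq, ha.1, ha.2]
        constructor <;> rintro ⟨h, h'⟩ <;> first | exact ⟨h'.symm, h⟩ | exact ⟨h', h.symm⟩
      rw [h3, ha.2, ← ha.1]
      ring
    rw [sum_congr rfl h2, ← mul_sum, ← sum_div]
    exact mul_le_of_le_one_right (hκ _ _) (div_self_le_one _)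
  have h4 : ∀ a, p a * (log (κ (f a) (W a)) + log (P a) - log (R a))
      ≤ p a * (κ (f a) (W a) * P a / R a) - p a := by
    intro a
    by_cases ha : p a = 0
    · simp [ha]
    have hPa : 0 < P a := levelMass_pos hp _ ha
    have hRa : 0 < R a := levelMass_pos hp _ ha
    have hκa := hpos a ha
    rw [← log_mul hκa.ne' hPa.ne', ← log_div (by positivity) hRa.ne', ← mul_sub_one]
    exact mul_le_mul_of_nonneg_left (log_le_sub_one_of_pos (by positivity)) (hp a)
  have h5 := sum_le_sum fun a (_ : a ∈ univ) => h4 a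
  rw [sum_sub_distrib] at h5
  have h6 : ∑ a, p a * (log (κ (f a) (W a)) + log (P a) - log (R a))
      = ∑ a, p a * log (κ (f a) (W a)) + ∑ a, p a * log (P a) - ∑ a, p a * log (R a) := by
    rw [← sum_add_distrib, ← sum_sub_distrib]
    exact sum_congr rfl fun a _ => by ring
  simp only [condEntropy, entropy]
  linarith

lemma condEntropy_le_log_card [Fintype β] [Nonempty β] (hp : ∀ a, 0 ≤ p a) (hp1 : ∑ a, p a = 1)
    (f : α → β) (W : α → γ) : condEntropy p f W ≤ log (Fintype.card β) := by
  have hc : (0 : ℝ) < Fintype.card β := by exact_mod_cast Fintype.card_pos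
  refine (condEntropy_le_cross hp f W (fun _ _ => (Fintype.card β : ℝ)⁻¹) (fun _ _ => by positivity)
    (fun _ => ?_) fun _ _ => by positivity).trans ?_
  · simp [hc.ne']
  · simp [← sum_mul, hp1]

/-- Conditioning on more reduces the entropy. -/
lemma condEntropy_anti [Fintype β] (hp : ∀ a, 0 ≤ p a) (f : α → β) {W : α → γ} {V : α → δ}
    (h : ∀ a b, W a = W b → V a = V b) : condEntropy p f W ≤ condEntropy p f V := by
  -- `κ(v | w)` is the conditional probability of `f = v` given the value of `V` that `w` determines
  set κ : β → γ → ℝ := fun v w => if hw : ∃ a, W a = w then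
    (∑ b with f b = v ∧ V b = V hw.choose, p b) / levelMass p V hw.choose else 0 with hκ
  have hκW : ∀ a, κ (f a) (W a) = levelMass p (fun a => (f a, V a)) a / levelMass p V a := by
    intro a
    have hw : ∃ b, W b = W a := ⟨a, rfl⟩
    have hV : V hw.choose = V a := h _ _ hw.choose_spec
    simp only [hκ, dif_pos hw, levelMass, hV, Prod.mk.injEq]
  have hpos : ∀ a, p a ≠ 0 → 0 < κ (f a) (W a) := fun a ha => by
    rw [hκW]; exact div_pos (levelMass_pos hp _ ha) (levelMass_pos hp _ ha)
  refine (condEntropy_le_cross hp f W κ (fun v w => ?_) (fun w => ?_) hpos).trans_eq ?_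
  · simp only [hκ]
    split_ifs
    · exact div_nonneg (sum_nonneg fun b _ => hp b) (sum_nonneg fun b _ => hp b)
    · exact le_rfl
  · by_cases hw : ∃ a, W a = w
    · simp only [hκ, dif_pos hw]
      rw [← sum_div]
      refine le_trans (le_of_eq ?_) (div_self_le_one (levelMass p V hw.choose))
      congr 1
      rw [levelMass, ← sum_fiberwise _ f]
      refine sum_congr rfl fun v _ => ?_
      rw [filter_filter]
      refine sum_congr ?_ fun _ _ => rfl
      ext c; simp [and_comm]
    · simp [hκ, dif_neg hw]
  · simp only [condEntropy, entropy]
    rw [neg_sub_neg, ← sum_sub_distrib, ← sum_neg_distrib]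
    refine sum_congr rfl fun a _ => ?_
    by_cases ha : p a = 0
    · simp [ha]
    rw [hκW, log_div (levelMass_pos hp _ ha).ne' (levelMass_pos hp _ ha).ne']
    ring

/-- **Fano's inequality** for a bit `b` estimated from `W`: the entropy of `b` given `W` is at most
the code length of the error event under the error probability `ε`. As a bound affine in the
true error probability it can be averaged without an appeal to concavity. -/
lemma condEntropy_le_fano (hp : ∀ a, 0 ≤ p a) (hp1 : ∑ a, p a = 1) (b : α → Bool) (W : α → γ)
    (D : γ → Bool) {ε : ℝ} (h0 : 0 < ε) (h1 : ε < 1) :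
    condEntropy p b W
      ≤ (∑ a with b a ≠ D (W a), p a) * (log (1 - ε) - log ε) - log (1 - ε) := by
  refine (condEntropy_le_cross hp b W (fun v w => if v = D w then 1 - ε else ε)
    (fun v w => by split_ifs <;> linarith) (fun w => ?_) fun a _ => ?_).trans_eq ?_
  · rw [Fintype.sum_bool]
    cases D w <;> simp
  · split_ifs <;> linarith
  · have h2 : ∀ a, p a * log (if b a = D (W a) then 1 - ε else ε)
        = p a * log (1 - ε) - (if b a ≠ D (W a) then p a else 0) * (log (1 - ε) - log ε) := by
      intro a
      by_cases h : b a = D (W a) <;> simp [h, mul_sub]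
    simp only [h2, sum_sub_distrib, ← sum_mul, hp1, sum_filter]
    ring

/-- Subadditivity: the conditional entropy of a vector is at most the sum over its entries. -/
lemma condEntropy_pi_le {ι : Type*} [Fintype ι] [Fintype β] (hp : ∀ a, 0 ≤ p a)
    (F : ι → α → β) (W : α → γ) :
    condEntropy p (fun a i => F i a) W ≤ ∑ i, condEntropy p (F i) W := by
  have key : ∀ s : Finset ι, condEntropy p (fun a (i : s) => F i a) W
      ≤ ∑ i ∈ s, condEntropy p (F i) W := by
    intro s
    induction s using Finset.induction_on with
    | empty => exact (condEntropy_eq_zero fun a b _ => funext fun i => absurd i.2 (notMem_empty _)).le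
    | insert j s hj ih =>
      rw [sum_insert hj]
      have h1 : condEntropy p (fun a (i : (insert j s : Finset ι)) => F i a) W
          = condEntropy p (F j) (fun a => (fun i : s => F i a, W a))
            + condEntropy p (fun a (i : s) => F i a) W := by
        simp only [condEntropy]
        rw [sub_add_sub_cancel, entropy_congr]
        intro a b
        simp [funext_iff, and_assoc]
      have h2 : condEntropy p (F j) (fun a => (fun i : s => F i a, W a)) ≤ condEntropy p (F j) W :=
        condEntropy_anti hp _ fun _ _ h => congrArg Prod.snd h
      linarith
  refine (condEntropy_congr (fun a b => ?_) fun a b => Iff.rfl).trans_le (key univ)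
  simp [funext_iff]

end Entropy

/-! ### Entropy accounting along the transmission -/

section Accounting

open Finset Real

variable {α σ τ : Type*}

/-- The first `n` terms of a sequence of random variables, as one random variable. -/
def initSeg (y : ℕ → α → σ) (n : ℕ) (a : α) : Fin n → σ := fun i => y i a

lemma initSeg_eq_iff {y : ℕ → α → σ} {n : ℕ} {a b : α} :
    initSeg y n a = initSeg y n b ↔ ∀ i < n, y i a = y i b := by
  simp [initSeg, funext_iff, Fin.forall_iff]

lemma initSeg_succ_eq_iff {y : ℕ → α → σ} {n : ℕ} {a b : α} :
    initSeg y (n + 1) a = initSeg y (n + 1) b ↔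
      y n a = y n b ∧ initSeg y n a = initSeg y n b := by
  simp only [initSeg_eq_iff, Nat.lt_succ_iff_lt_or_eq, or_imp, forall_and, forall_eq, and_comm]

variable [Fintype α] {p : α → ℝ}

lemma condEntropy_initSeg (y : ℕ → α → σ) (V : α → τ) (n : ℕ) :
    condEntropy p (y n) (fun a => (initSeg y n a, V a)) =
      entropy p (fun a => (initSeg y (n + 1) a, V a)) - entropy p (fun a => (initSeg y n a, V a)) := by
  rw [condEntropy, entropy_congr]
  intro a b
  simp [initSeg_succ_eq_iff, and_assoc]

/-- Appending further message bits costs at most their conditional entropies given `V`, which Fano's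
inequality bounds when the bits are decoded from `V`. -/
lemma entropy_append_le [Fintype σ] (hp : ∀ a, 0 ≤ p a) (M : ℕ → α → σ) (V : α → τ) {l l' : ℕ}
    (h : l ≤ l') :
    entropy p (fun a => (V a, initSeg M l' a)) ≤
      entropy p (fun a => (V a, initSeg M l a)) + ∑ i ∈ Ico l l', condEntropy p (M i) V := by
  induction l', h using Nat.le_induction with
  | base => simp
  | succ l' hl ih =>
    rw [sum_Ico_succ_top hl]
    have h1 := condEntropy_initSeg (p := p) M V l'
    have h2 : condEntropy p (M l') (fun a => (initSeg M l' a, V a)) ≤ condEntropy p (M l') V :=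
      condEntropy_anti hp _ fun _ _ h => congrArg Prod.snd h
    have h3 : ∀ n, entropy p (fun a => (initSeg M n a, V a))
        = entropy p (fun a => (V a, initSeg M n a)) := fun n =>
      entropy_congr fun a b => by simp [and_comm]
    rw [h3, h3] at h1
    linarith

variable {d : ℕ}

/-- The fresh information in the symbols `y` of one transmitter up to time `N`: the entropy of each
symbol given the earlier ones and the first `m n` message bits, which count as known at time `n`. -/
noncomputable def freshInfo (p : α → ℝ) (M : ℕ → α → Bool) (m : ℕ → ℕ) (y : ℕ → α → Option Bool)
    (N : ℕ) : ℝ :=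
  ∑ n ∈ range N, condEntropy p (y n) fun a => (initSeg y n a, initSeg M (m n) a)

/-- If the received symbols are revealed one time step after the other, and the bits decoded from
them as soon as they are decoded, then each transmitter contributes its fresh information only. -/
lemma entropy_interleaved_le (hp : ∀ a, 0 ≤ p a) (hp1 : ∑ a, p a = 1) (M : ℕ → α → Bool)
    {m : ℕ → ℕ} (m0 : m 0 = 0) (hm : Monotone m) (Y : Fin d → ℕ → α → Option Bool) (N : ℕ) :
    entropy p (fun a => (initSeg (fun n a k => Y k n a) N a, initSeg M (m N) a)) ≤
      ∑ k, freshInfo p M m (Y k) N + ∑ n ∈ range N, ∑ i ∈ Ico (m n) (m (n + 1)),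
        condEntropy p (M i) (initSeg (fun n a k => Y k n a) (n + 1)) := by
  induction N with
  | zero =>
    refine (entropy_eq_zero_of_const hp1 fun a b => ?_).trans_le (by simp [freshInfo])
    simp [initSeg_eq_iff, m0]
  | succ N ih =>
    set Z : ℕ → α → Fin d → Option Bool := fun n a k => Y k n a
    have h1 := entropy_append_le hp M (initSeg Z (N + 1)) (hm N.le_succ)
    have h2 := condEntropy_initSeg (p := p) Z (initSeg M (m N)) N
    have h3 := condEntropy_pi_le hp (fun k => Y k N) (fun a => (initSeg Z N a, initSeg M (m N) a))
    have h4 : ∑ k, condEntropy p (Y k N) (fun a => (initSeg Z N a, initSeg M (m N) a)) ≤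
        ∑ k, condEntropy p (Y k N) (fun a => (initSeg (Y k) N a, initSeg M (m N) a)) := by
      refine sum_le_sum fun k _ => condEntropy_anti hp _ fun a b h => ?_
      simp only [Prod.mk.injEq, initSeg_eq_iff] at h ⊢
      exact ⟨fun i hi => congrFun (h.1 i hi) k, h.2⟩
    have h5 : ∑ k, freshInfo p M m (Y k) (N + 1) = ∑ k, freshInfo p M m (Y k) N +
        ∑ k, condEntropy p (Y k N) (fun a => (initSeg (Y k) N a, initSeg M (m N) a)) := by
      rw [← sum_add_distrib]
      exact sum_congr rfl fun k _ => sum_range_succ _ _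
    rw [sum_range_succ, h5]
    linarith

/-- The recursion for the fresh information: after time `N'`, knowing the bits decoded so far can
only leave less information in the symbols of a transmitter than knowing the first `l` bits. -/
lemma freshInfo_le (hp : ∀ a, 0 ≤ p a) (M : ℕ → α → Bool) {m : ℕ → ℕ} (hm : Monotone m)
    (y : ℕ → α → Option Bool) {l N' N : ℕ} (hN : N' ≤ N) (hl : l ≤ m N') :
    freshInfo p M m y N ≤ freshInfo p M m y N' +
      (entropy p (fun a => (initSeg y N a, initSeg M l a)) - entropy p (initSeg M l)) := by
  have key : freshInfo p M m y N ≤ freshInfo p M m y N' +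
      (entropy p (fun a => (initSeg y N a, initSeg M l a)) -
        entropy p (fun a => (initSeg y N' a, initSeg M l a))) := by
    induction N, hN using Nat.le_induction with
    | base => simp
    | succ N hN ih =>
      have h1 := condEntropy_initSeg (p := p) y (initSeg M l) N
      have h2 : condEntropy p (y N) (fun a => (initSeg y N a, initSeg M (m N) a)) ≤
          condEntropy p (y N) (fun a => (initSeg y N a, initSeg M l a)) := by
        refine condEntropy_anti hp _ fun a b h => ?_
        simp only [Prod.mk.injEq, initSeg_eq_iff] at h ⊢
        exact ⟨h.1, fun i hi => h.2 i (hi.trans_le (hl.trans (hm hN)))⟩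
      have h3 : freshInfo p M m y (N + 1) = freshInfo p M m y N +
        condEntropy p (y N) (fun a => (initSeg y N a, initSeg M (m N) a)) := sum_range_succ _ _
      linarith
  have : entropy p (initSeg M l) ≤ entropy p (fun a => (initSeg y N' a, initSeg M l a)) :=
    entropy_le_pair hp _ _
  linarith

/-- Only symbols that are not erased carry information. -/
lemma condEntropy_erase_le (hp : ∀ a, 0 ≤ p a) (hp1 : ∑ a, p a = 1) (e : Bool) (x : α → Bool)
    (W : α → τ) :
    condEntropy p (fun a => if e then none else some (x a)) W ≤ if e then 0 else log 2 := by
  cases e with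
  | true => exact (condEntropy_eq_zero fun _ _ _ => by simp).le
  | false =>
    refine (condEntropy_congr (f' := x) (W' := W) (fun a b => by simp) fun a b => Iff.rfl).trans_le ?_
    simpa using condEntropy_le_log_card hp hp1 x W

lemma freshInfo_erase_le (hp : ∀ a, 0 ≤ p a) (hp1 : ∑ a, p a = 1) (M : ℕ → α → Bool) (m : ℕ → ℕ)
    (e : ℕ → Bool) (x : ℕ → α → Bool) (N : ℕ) :
    freshInfo p M m (fun n a => if e n then none else some (x n a)) N ≤
      ∑ n ∈ range N, if e n then 0 else log 2 :=
  sum_le_sum fun n _ => condEntropy_erase_le hp hp1 (e n) (x n) _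

lemma entropy_initSeg_erase_le (hp : ∀ a, 0 ≤ p a) (hp1 : ∑ a, p a = 1)
    (e : ℕ → Bool) (x : ℕ → α → Bool) (N : ℕ) :
    entropy p (initSeg (fun n a => if e n then none else some (x n a)) N) ≤
      ∑ n ∈ range N, if e n then 0 else log 2 := by
  set y : ℕ → α → Option Bool := fun n a => if e n then none else some (x n a) with hy
  have h : ∀ n, entropy p (initSeg y n) = entropy p (fun a => (initSeg y n a, ())) := fun n =>
    entropy_congr fun a b => by simp
  rw [h]
  induction N with
  | zero => exact (entropy_eq_zero_of_const hp1 fun a b => by simp [initSeg_eq_iff]).trans_le (by simp)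
  | succ N ih =>
    have h1 := condEntropy_initSeg (p := p) y (fun _ => ()) N
    have h2 := condEntropy_erase_le hp hp1 (e N) (x N) (fun a => (initSeg y N a, ()))
    rw [sum_range_succ]
    simp only [hy] at h1 h2 ih ⊢
    linarith

lemma entropy_of_uniform (hp1 : ∑ a, p a = 1) {M : ℕ → α → Bool} {l : ℕ}
    (h : ∀ a, levelMass p (initSeg M l) a = (2⁻¹) ^ l) :
    entropy p (initSeg M l) = l * log 2 := by
  simp [entropy, h, ← sum_mul, hp1]

end Accounting

/-! ### Error probabilities for given common randomness and erasures -/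

section Conditioning

open Finset Real

variable {d : ℕ} (C : MRSCode d)

/-- The probability, over the message alone, that the bit with index `i` is decoded wrongly at time
`n`, for given common randomness `z.1` and erasure pattern `z.2`. -/
noncomputable def MRSCode.errAt (z : C.Q × (ℕ × Fin d → Bool)) (n i : ℕ) : ℝ :=
  messageLaw.real {M | M i ≠ C.dec z.1 n (received (C.enc z.1 M) z.2 n) i}

lemma MRSCode.measurableSet_error (n i : ℕ) :
    MeasurableSet {ω : C.Q × (ℕ → Bool) × (ℕ × Fin d → Bool) |
      ω.2.1 i ≠ C.dec ω.1 n (received (C.enc ω.1 ω.2.1) ω.2.2 n) i} := by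
  have h : {ω : C.Q × (ℕ → Bool) × (ℕ × Fin d → Bool) |
      ω.2.1 i ≠ C.dec ω.1 n (received (C.enc ω.1 ω.2.1) ω.2.2 n) i} =
      ⋃ y : Fin n → Fin d → Option Bool, ({ω | ω.2.1 i ≠ C.dec ω.1 n y i} ∩
        ⋂ j, ⋂ k, {ω | received (C.enc ω.1 ω.2.1) ω.2.2 n j k = y j k}) := by
    ext ω
    simp only [Set.mem_ofPred_eq, Set.mem_iUnion, Set.mem_inter_iff, Set.mem_iInter]
    constructor
    · exact fun h => ⟨_, h, fun _ _ => rfl⟩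
    · rintro ⟨y, h, hy⟩
      rwa [show received (C.enc ω.1 ω.2.1) ω.2.2 n = y from funext fun j => funext fun k => hy j k]
  rw [h]
  refine MeasurableSet.iUnion fun y => MeasurableSet.inter ?_ ?_
  · have h1 : Measurable fun ω : C.Q × (ℕ → Bool) × (ℕ × Fin d → Bool) =>
        (ω.2.1 i, C.dec ω.1 n y i) :=
      Measurable.prodMk (by fun_prop) ((C.measurable_dec n y i).comp measurable_fst)
    exact h1 (Set.toFinite {b : Bool × Bool | b.1 ≠ b.2}).measurableSet
  · refine MeasurableSet.iInter fun j => MeasurableSet.iInter fun k => ?_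
    have h1 : Measurable fun ω : C.Q × (ℕ → Bool) × (ℕ × Fin d → Bool) =>
        (ω.2.2 (j, k), C.enc ω.1 ω.2.1 k j) :=
      Measurable.prodMk (by fun_prop) ((C.measurable_enc k j).comp
        (measurable_fst.prodMk (measurable_fst.comp measurable_snd)))
    exact h1 (Set.toFinite {b : Bool × Bool | (if b.1 then none else some b.2) = y j k}).measurableSet

lemma MRSCode.integral_errAt (c : Fin d → unitInterval) (n i : ℕ) :
    Measurable (fun z => C.errAt z n i) ∧
    ∫ z, C.errAt z n i ∂(C.law.prod (erasureLaw c)) = C.errorProb c n i := by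
  set S := {ω : C.Q × (ℕ → Bool) × (ℕ × Fin d → Bool) |
      ω.2.1 i ≠ C.dec ω.1 n (received (C.enc ω.1 ω.2.1) ω.2.2 n) i} with hS
  have hm : MeasurableSet S := C.measurableSet_error n i
  have hmeas : Measurable fun z : (C.Q × (ℕ × Fin d → Bool)) =>
      messageLaw {M | M i ≠ C.dec z.1 n (received (C.enc z.1 M) z.2 n) i} := by
    have h1 : MeasurableSet {x : (C.Q × (ℕ × Fin d → Bool)) × (ℕ → Bool) |
        (x.1.1, x.2, x.1.2) ∈ S} := by
      refine hm.preimage ?_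
      fun_prop
    exact measurable_measure_prodMk_left h1
  refine ⟨hmeas.ennreal_toReal, ?_⟩
  unfold MRSCode.errAt MRSCode.errorProb
  simp only [measureReal_def]
  rw [integral_toReal hmeas.aemeasurable (by simp), lintegral_prod _ hmeas.aemeasurable,
    Measure.prod_apply hm]
  congr 1
  refine lintegral_congr fun q => ?_
  rw [Measure.prod_apply_symm (measurable_prodMk_left hm)]
  rfl

lemma MRSCode.errAt_nonneg (z : C.Q × (ℕ × Fin d → Bool)) (n i : ℕ) : 0 ≤ C.errAt z n i :=
  measureReal_nonneg

lemma MRSCode.integrable_errAt (c : Fin d → unitInterval) (n i : ℕ) :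
    Integrable (fun z => C.errAt z n i) (C.law.prod (erasureLaw c)) := by
  refine Integrable.of_bound (C.integral_errAt c n i).1.aestronglyMeasurable 1 (ae_of_all _ fun z => ?_)
  rw [Real.norm_of_nonneg (C.errAt_nonneg z n i)]
  exact measureReal_le_one

/-- Erase everything that is not sent by Transmitter `k`. -/
def mask (k : Fin d) (e : ℕ × Fin d → Bool) : ℕ × Fin d → Bool :=
  fun x => if x.2 = k then e x else true

/-- The capacity vector of a receiver that hears Transmitter `k` only. -/
def onlyCapacity (c : Fin d → unitInterval) (k : Fin d) : Fin d → unitInterval :=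
  fun j => if j = k then c k else 0

lemma measurable_mask (k : Fin d) : Measurable (mask k) := by
  refine measurable_pi_lambda _ fun x => ?_
  unfold mask
  split_ifs <;> fun_prop

/-- The receiver that hears Transmitter `k` only is realized on the probability space of the
receiver that hears all of them. -/
lemma map_mask_erasureLaw (c : Fin d → unitInterval) (k : Fin d) :
    (erasureLaw c).map (mask k) = erasureLaw (onlyCapacity c k) := by
  have h := Measure.infinitePi_map_pi
    (μ := fun p : ℕ × Fin d => bernoulliMeasure true false (unitInterval.symm (c p.2)))
    (f := fun p b => if p.2 = k then b else true) (fun p => measurable_of_finite _)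
  refine Eq.trans h ?_
  unfold erasureLaw
  congr 1
  funext p
  by_cases hp : p.2 = k
  · simp [hp, onlyCapacity]
  · simp [hp, onlyCapacity]

lemma integrable_errAt_mask (c : Fin d → unitInterval) (k : Fin d) (n i : ℕ) :
    Integrable (fun z : C.Q × (ℕ × Fin d → Bool) => C.errAt (z.1, mask k z.2) n i)
      (C.law.prod (erasureLaw c)) := by
  refine Integrable.of_bound (Measurable.aestronglyMeasurable ?_) 1 (ae_of_all _ fun z => ?_)
  · have := measurable_mask k
    exact (C.integral_errAt c n i).1.comp (by fun_prop)
  rw [Real.norm_of_nonneg (C.errAt_nonneg _ n i)]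
  exact measureReal_le_one

lemma integral_errAt_mask (c : Fin d → unitInterval) (k : Fin d) (n i : ℕ) :
    ∫ z : C.Q × (ℕ × Fin d → Bool), C.errAt (z.1, mask k z.2) n i ∂(C.law.prod (erasureLaw c)) =
      C.errorProb (onlyCapacity c k) n i := by
  rw [← (C.integral_errAt (onlyCapacity c k) n i).2, ← map_mask_erasureLaw]
  have h1 : C.law.prod ((erasureLaw c).map (mask k)) =
      (C.law.prod (erasureLaw c)).map (Prod.map id (mask k)) := by
    rw [← Measure.map_prod_map _ _ measurable_id (measurable_mask k), Measure.map_id]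
  rw [h1, integral_map (measurable_id.prodMap (measurable_mask k)).aemeasurable
    (C.integral_errAt c n i).1.aestronglyMeasurable]
  rfl

lemma integral_unerased (c : Fin d → unitInterval) (k : Fin d) (n : ℕ) (r : ℝ) :
    Integrable (fun z : C.Q × (ℕ × Fin d → Bool) => if z.2 (n, k) then 0 else r)
      (C.law.prod (erasureLaw c)) ∧
    ∫ z : C.Q × (ℕ × Fin d → Bool), (if z.2 (n, k) then 0 else r) ∂(C.law.prod (erasureLaw c)) =
      c k * r := by
  have hf : Measurable fun b : Bool => if b then 0 else r := measurable_of_finite _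
  constructor
  · refine Integrable.of_bound (Measurable.aestronglyMeasurable ?_) |r| (ae_of_all _ fun z => ?_)
    · exact hf.comp (by fun_prop)
    · split_ifs <;> simp
  · rw [integral_fun_snd (fun e : ℕ × Fin d → Bool => if e (n, k) then 0 else r)]
    have h1 : ∫ e, (if e (n, k) then 0 else r) ∂erasureLaw c =
        ∫ b, (if b then 0 else r) ∂((erasureLaw c).map fun e => e (n, k)) := by
      have hm : Measurable fun e : ℕ × Fin d → Bool => e (n, k) := measurable_pi_apply _
      rw [integral_map hm.aemeasurable hf.aestronglyMeasurable]
    rw [h1, erasureLaw, Measure.infinitePi_map_eval, integral_bernoulliMeasure]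
    simp

end Conditioning

/-! ### The finite sample space of a message prefix and the sent symbols -/

section Model

open Finset Real

variable {d : ℕ} (C : MRSCode d)

/-- The outcomes of the first `L` message bits and the first `L` (vector) symbols sent. -/
abbrev Outcome (d L : ℕ) : Type := Fin L → Bool × (Fin d → Bool)

/-- The outcome of a message, for given common randomness. -/
def MRSCode.outcome (L : ℕ) (q : C.Q) (M : ℕ → Bool) : Outcome d L :=
  fun i => (M i, fun k => C.enc q M k i)

/-- The law of the outcome of a fair random message. -/
noncomputable def MRSCode.outcomeLaw (L : ℕ) (q : C.Q) (a : Outcome d L) : ℝ :=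
  (messageLaw.map (C.outcome L q)).real {a}

/-- The message bit with index `i`, as a random variable on the finite sample space. -/
def Outcome.bit {L : ℕ} (i : ℕ) (a : Outcome d L) : Bool :=
  if h : i < L then (a ⟨i, h⟩).1 else false

/-- The symbol that Transmitter `k` sends, as a random variable on the finite sample space. -/
def Outcome.symbol {L : ℕ} (k : Fin d) (n : ℕ) (a : Outcome d L) : Bool :=
  if h : n < L then (a ⟨n, h⟩).2 k else false

/-- The symbol received from Transmitter `k` under the erasure pattern `e`. -/
def Outcome.output {L : ℕ} (e : ℕ × Fin d → Bool) (k : Fin d) (n : ℕ) (a : Outcome d L) :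
    Option Bool :=
  if e (n, k) then none else some (Outcome.symbol k n a)

lemma MRSCode.measurable_outcome (L : ℕ) (q : C.Q) : Measurable (C.outcome L q) := by
  refine measurable_pi_lambda _ fun i => Measurable.prodMk (measurable_pi_apply _) ?_
  exact measurable_pi_lambda _ fun k => (C.measurable_enc k i).comp measurable_prodMk_left

lemma MRSCode.outcomeLaw_nonneg (L : ℕ) (q : C.Q) (a : Outcome d L) : 0 ≤ C.outcomeLaw L q a :=
  measureReal_nonneg

lemma MRSCode.sum_outcomeLaw (L : ℕ) (q : C.Q) (s : Finset (Outcome d L)) :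
    ∑ a ∈ s, C.outcomeLaw L q a = messageLaw.real {M | C.outcome L q M ∈ s} := by
  unfold MRSCode.outcomeLaw
  rw [sum_measureReal_singleton, map_measureReal_apply (C.measurable_outcome L q) s.measurableSet]
  rfl

lemma MRSCode.sum_outcomeLaw_univ (L : ℕ) (q : C.Q) : ∑ a, C.outcomeLaw L q a = 1 := by
  simp [C.sum_outcomeLaw]

lemma messageLaw_cylinder (l : ℕ) (b : ℕ → Bool) :
    messageLaw.real {M | ∀ i < l, M i = b i} = (2⁻¹) ^ l := by
  have h : {M : ℕ → Bool | ∀ i < l, M i = b i} = Set.pi (range l) fun i => {b i} := by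
    ext M; simp
  rw [h, messageLaw, measureReal_def, Measure.infinitePi_pi _ fun _ _ => measurableSet_singleton _,
    ENNReal.toReal_prod]
  refine (prod_congr rfl fun i _ => (?_ : _ = (2⁻¹ : ℝ))).trans (by simp)
  rw [← measureReal_def]
  cases b i
  · rw [bernoulliMeasure_real_apply_of_notMem_of_mem _ (measurableSet_singleton _) (by simp)
      (by simp)]
    norm_num
  · rw [bernoulliMeasure_real_apply_of_mem_of_notMem _ (measurableSet_singleton _) (by simp)
      (by simp)]
    norm_num

lemma MRSCode.levelMass_bits {L l : ℕ} (hl : l ≤ L) (q : C.Q) (a : Outcome d L) :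
    levelMass (C.outcomeLaw L q) (initSeg Outcome.bit l) a = (2⁻¹) ^ l := by
  rw [levelMass, C.sum_outcomeLaw, ← messageLaw_cylinder l fun i => Outcome.bit i a]
  congr 1
  ext M
  simp only [Set.mem_ofPred_eq, mem_filter, mem_univ, true_and, initSeg_eq_iff]
  refine forall₂_congr fun i hi => ?_
  simp [Outcome.bit, hi.trans_le hl, MRSCode.outcome]

lemma MRSCode.entropy_bits {L l : ℕ} (hl : l ≤ L) (q : C.Q) :
    entropy (C.outcomeLaw L q) (initSeg Outcome.bit l) = l * log 2 :=
  entropy_of_uniform (C.sum_outcomeLaw_univ L q) (C.levelMass_bits hl q)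

/-- The bound of Fano's inequality for the tolerated error probability `ε` and the true error
probability `x`. -/
noncomputable def fano (ε x : ℝ) : ℝ := x * (log (1 - ε) - log ε) - log (1 - ε)

lemma fano_le {ε x : ℝ} (h0 : 0 < ε) (h1 : ε ≤ 1 / 2) (hx : x ≤ ε) : fano ε x ≤ binEntropy ε := by
  have h2 : log ε ≤ log (1 - ε) := log_le_log h0 (by linarith)
  have h3 : x * (log (1 - ε) - log ε) ≤ ε * (log (1 - ε) - log ε) :=
    mul_le_mul_of_nonneg_right hx (by linarith)
  rw [fano, binEntropy_eq_negMulLog_add_negMulLog_one_sub]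
  simp only [negMulLog]
  linarith

/-- Fano's inequality for a receiver whose received vector is a function of `W`. -/
lemma MRSCode.condEntropy_bit_le {L n i : ℕ} (hn : n ≤ L) (hi : i < L) (q : C.Q)
    (e : ℕ × Fin d → Bool) {γ : Type*} (W : Outcome d L → γ) (V : γ → Fin n → Fin d → Option Bool)
    (hV : ∀ a j k, V (W a) j k = Outcome.output e k j a) {ε : ℝ} (h0 : 0 < ε) (h1 : ε < 1) :
    condEntropy (C.outcomeLaw L q) (Outcome.bit i) W ≤ fano ε (C.errAt (q, e) n i) := by
  refine (condEntropy_le_fano (C.outcomeLaw_nonneg L q) (C.sum_outcomeLaw_univ L q) _ W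
    (fun w => C.dec q n (V w) i) h0 h1).trans_eq ?_
  rw [fano, C.sum_outcomeLaw, MRSCode.errAt]
  congr 3
  ext M
  have hb : Outcome.bit i (C.outcome L q M) = M i := by simp [Outcome.bit, hi, MRSCode.outcome]
  have hy : V (W (C.outcome L q M)) = received (C.enc q M) e n := by
    funext j k
    rw [hV]
    simp [Outcome.output, Outcome.symbol, j.2.trans_le hn, MRSCode.outcome, received]
  simp only [Set.mem_ofPred_eq, mem_filter, mem_univ, true_and, hb, hy]

/-- The fresh information of Transmitter `k` for given common randomness and erasures. -/
noncomputable def MRSCode.fresh (L : ℕ) (m : ℕ → ℕ) (k : Fin d) (N : ℕ)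
    (z : C.Q × (ℕ × Fin d → Bool)) : ℝ :=
  freshInfo (C.outcomeLaw L z.1) Outcome.bit m (Outcome.output z.2 k) N

variable {C} {L : ℕ} {m : ℕ → ℕ} {ε : ℝ}

lemma MRSCode.le_sum_fresh (m0 : m 0 = 0) (hm : Monotone m) {N : ℕ} (hN : N ≤ L) (hmN : m N ≤ L)
    (h0 : 0 < ε) (h1 : ε < 1) (z : C.Q × (ℕ × Fin d → Bool)) :
    m N * log 2 ≤ ∑ k, C.fresh L m k N z +
      ∑ n ∈ range N, ∑ i ∈ Ico (m n) (m (n + 1)), fano ε (C.errAt z (n + 1) i) := by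
  have h2 := entropy_interleaved_le (C.outcomeLaw_nonneg L z.1) (C.sum_outcomeLaw_univ L z.1)
    Outcome.bit m0 hm (Outcome.output z.2) N
  rw [← C.entropy_bits hmN z.1]
  refine (entropy_le_pair (C.outcomeLaw_nonneg L z.1) _ _).trans (h2.trans ?_)
  refine add_le_add le_rfl (sum_le_sum fun n hn => sum_le_sum fun i hi => ?_)
  have hn' := mem_range.1 hn
  exact C.condEntropy_bit_le (by omega)
    (((mem_Ico.1 hi).2.trans_le (hm hn')).trans_le hmN) z.1 z.2 _ (fun y => y)
    (fun a j k => rfl) h0 h1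

lemma MRSCode.entropy_output_le {N l : ℕ} (hN : N ≤ L) (hl : l ≤ L) (k : Fin d)
    (h0 : 0 < ε) (h1 : ε < 1) (z : C.Q × (ℕ × Fin d → Bool)) :
    entropy (C.outcomeLaw L z.1)
        (fun a => (initSeg (Outcome.output z.2 k) N a, initSeg Outcome.bit l a)) ≤
      ∑ n ∈ range N, (if z.2 (n, k) then 0 else log 2) +
        ∑ i ∈ range l, fano ε (C.errAt (z.1, mask k z.2) N i) := by
  have hp := C.outcomeLaw_nonneg L z.1
  have hp1 := C.sum_outcomeLaw_univ L z.1
  have h2 := entropy_append_le hp Outcome.bit (initSeg (Outcome.output z.2 k) N) (Nat.zero_le l)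
  have h3 := entropy_initSeg_erase_le hp hp1 (fun n => z.2 (n, k)) (Outcome.symbol k) N
  have h4 : entropy (C.outcomeLaw L z.1)
      (fun a => (initSeg (Outcome.output z.2 k) N a, initSeg Outcome.bit 0 a)) =
      entropy (C.outcomeLaw L z.1) (initSeg (Outcome.output z.2 k) N) :=
    entropy_congr fun a b => by simp [initSeg_eq_iff]
  have h5 : ∑ i ∈ Ico 0 l, condEntropy (C.outcomeLaw L z.1) (Outcome.bit i)
      (initSeg (Outcome.output z.2 k) N) ≤
        ∑ i ∈ range l, fano ε (C.errAt (z.1, mask k z.2) N i) := by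
    rw [← range_eq_Ico]
    refine sum_le_sum fun i hi => C.condEntropy_bit_le hN ((mem_range.1 hi).trans_le hl) z.1 _ _
      (fun y j k' => if k' = k then y j else none) (fun a j k' => ?_) h0 h1
    by_cases hk : k' = k
    · subst hk; simp [initSeg, Outcome.output, mask]
    · simp [Outcome.output, mask, hk]
  rw [h4] at h2
  exact h2.trans (add_le_add h3 h5)

lemma MRSCode.fresh_le {N' N l : ℕ} (hm : Monotone m) (hN' : N' ≤ N) (hN : N ≤ L) (hlm : l ≤ m N')
    (hl : l ≤ L) (k : Fin d) (h0 : 0 < ε) (h1 : ε < 1) (z : C.Q × (ℕ × Fin d → Bool)) :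
    C.fresh L m k N z ≤ C.fresh L m k N' z +
      (∑ n ∈ range N, (if z.2 (n, k) then 0 else log 2) +
        ∑ i ∈ range l, fano ε (C.errAt (z.1, mask k z.2) N i) - l * log 2) := by
  have h2 := freshInfo_le (C.outcomeLaw_nonneg L z.1) Outcome.bit hm (Outcome.output z.2 k) hN' hlm
  have h3 := C.entropy_output_le hN hl k h0 h1 z
  rw [C.entropy_bits hl] at h2
  unfold MRSCode.fresh
  linarith

lemma MRSCode.bits_le {N l : ℕ} (hN : N ≤ L) (hl : l ≤ L) (k : Fin d)
    (h0 : 0 < ε) (h1 : ε < 1) (z : C.Q × (ℕ × Fin d → Bool)) :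
    l * log 2 ≤ ∑ n ∈ range N, (if z.2 (n, k) then 0 else log 2) +
        ∑ i ∈ range l, fano ε (C.errAt (z.1, mask k z.2) N i) := by
  rw [← C.entropy_bits hl z.1]
  exact (entropy_le_pair (C.outcomeLaw_nonneg L z.1) _ _).trans
    (C.entropy_output_le hN hl k h0 h1 z)

lemma MRSCode.fresh_le_const (N : ℕ) (k : Fin d) (z : C.Q × (ℕ × Fin d → Bool)) :
    C.fresh L m k N z ≤ N * log 2 := by
  refine (freshInfo_erase_le (C.outcomeLaw_nonneg L z.1) (C.sum_outcomeLaw_univ L z.1) _ m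
    (fun n => z.2 (n, k)) (Outcome.symbol k) N).trans ?_
  calc ∑ n ∈ range N, (if z.2 (n, k) then 0 else log 2) ≤ ∑ n ∈ range N, log 2 :=
        sum_le_sum fun n _ => by split_ifs; exacts [(log_pos one_lt_two).le, le_rfl]
    _ = N * log 2 := by simp

end Model

/-! ### The converse -/

section Converse

open Finset Real

lemma le_of_forall_nat_mul_le {a b K : ℝ} (N₀ : ℕ) (h : ∀ N : ℕ, N₀ ≤ N → a * N ≤ b * N + K) :
    a ≤ b := by
  by_contra! hab
  obtain ⟨N, hN⟩ := exists_nat_gt (K / (a - b))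
  rw [div_lt_iff₀ (by linarith)] at hN
  have h1 := h (max N N₀) (le_max_right _ _)
  have h2 : (N : ℝ) ≤ (max N N₀ : ℕ) := by exact_mod_cast le_max_left _ _
  nlinarith

variable {d : ℕ} {C : MRSCode d} {c : Fin d → unitInterval} {ε : ℝ}

/-- The number of unerased symbols, in nats, plus the Fano terms of the first `l` bits, for the
receiver that hears Transmitter `k` only. -/
noncomputable def MRSCode.budget (C : MRSCode d) (ε : ℝ) (k : Fin d) (N l : ℕ)
    (z : C.Q × (ℕ × Fin d → Bool)) : ℝ :=
  ∑ n ∈ range N, (if z.2 (n, k) then 0 else log 2) +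
    ∑ i ∈ range l, fano ε (C.errAt (z.1, mask k z.2) N i)

lemma integral_fano {Z : Type*} [MeasurableSpace Z] {μ : Measure Z} [IsProbabilityMeasure μ]
    {f : Z → ℝ} (hf : Integrable f μ) (ε : ℝ) :
    Integrable (fun z => fano ε (f z)) μ ∧ ∫ z, fano ε (f z) ∂μ = fano ε (∫ z, f z ∂μ) := by
  unfold fano
  refine ⟨(hf.mul_const _).sub (integrable_const _), ?_⟩
  rw [integral_sub (hf.mul_const _) (integrable_const _), integral_mul_const]
  simp

lemma MRSCode.integrable_budget (k : Fin d) (N l : ℕ) :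
    Integrable (C.budget ε k N l) (C.law.prod (erasureLaw c)) :=
  (integrable_finsetSum _ fun n _ => (integral_unerased C c k n _).1).add
    (integrable_finsetSum _ fun i _ => (integral_fano (integrable_errAt_mask C c k N i) ε).1)

lemma MRSCode.integral_budget_le (h0 : 0 < ε) (h1 : ε ≤ 1 / 2) (k : Fin d) {N l : ℕ}
    (h : ∀ i < l, C.errorProb (onlyCapacity c k) N i ≤ ε) :
    ∫ z, C.budget ε k N l z ∂(C.law.prod (erasureLaw c)) ≤ N * (c k * log 2) + l * binEntropy ε := by
  unfold MRSCode.budget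
  rw [integral_add (integrable_finsetSum _ fun n _ => (integral_unerased C c k n _).1)
    (integrable_finsetSum _ fun i _ => (integral_fano (integrable_errAt_mask C c k N i) ε).1),
    integral_finsetSum _ fun n _ => (integral_unerased C c k n _).1,
    integral_finsetSum _ fun i _ => (integral_fano (integrable_errAt_mask C c k N i) ε).1]
  refine add_le_add ?_ ?_
  · simp [(integral_unerased C c k _ _).2]
  · refine (sum_le_sum fun i hi => ?_).trans (by simp : ∑ i ∈ range l, binEntropy ε ≤ _)
    rw [(integral_fano (integrable_errAt_mask C c k N i) ε).2, integral_errAt_mask]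
    exact fano_le h0 h1 (h i (mem_range.1 hi))

lemma MRSCode.bits_le_capacity (h0 : 0 < ε) (h1 : ε ≤ 1 / 2) (k : Fin d) {N l : ℕ}
    (h : ∀ i < l, C.errorProb (onlyCapacity c k) N i ≤ ε) :
    l * log 2 ≤ N * (c k * log 2) + l * binEntropy ε := by
  refine le_trans ?_ (C.integral_budget_le (c := c) h0 h1 k h)
  have h2 : ∫ _z, l * log 2 ∂(C.law.prod (erasureLaw c)) = l * log 2 := by simp
  rw [← h2]
  exact integral_mono (integrable_const _) (C.integrable_budget k N l)
    fun z => MRSCode.bits_le (le_max_left N l) (le_max_right N l) k h0 (by linarith) z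

/-- The average fresh information of Transmitter `k` grows at most linearly. Its growth rate `γ` is
the fixed point of the recursion that relates the times `N` and `lam * N`. The fresh
information is dominated by an integrable `B`, so that its measurability plays no role. -/
lemma MRSCode.exists_fresh_le (h0 : 0 < ε) (h1 : ε ≤ 1 / 2) (k : Fin d) {N₀ : ℕ} {ρ₀ ρ lam η : ℝ}
    (hρ : 0 ≤ ρ) (hη : 0 < η) (hlam0 : 0 ≤ lam) (hlam1 : lam < 1) (hlam : lam * ρ₀ = ρ)
    (hρ0 : 0 < ρ₀) (hdec : ∀ N, N₀ ≤ N → ∀ i : ℕ, (i : ℝ) + 1 ≤ N * ρ →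
      C.errorProb (onlyCapacity c k) N i ≤ ε)
    (hrate : ρ * (log 2 - binEntropy ε) ≤ c k * log 2)
    {m : ℕ → ℕ} (hm : Monotone m) (hmN : ∀ n, N₀ ≤ n → m n = ⌊ρ₀ * n⌋₊) :
    ∃ K : ℝ, ∀ L N : ℕ, N ≤ L → m N ≤ L → ∃ B : C.Q × (ℕ × Fin d → Bool) → ℝ,
      Integrable B (C.law.prod (erasureLaw c)) ∧ (∀ z, C.fresh L m k N z ≤ B z) ∧
      ∫ z, B z ∂(C.law.prod (erasureLaw c)) ≤
        (c k * log 2 - ρ * (log 2 - binEntropy ε) + η) / (1 - lam) * N + K := by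
  set κ := c k * log 2 - ρ * (log 2 - binEntropy ε) with hκ
  set γ := (κ + η) / (1 - lam) with hγ
  have hlog : 0 < log 2 := log_pos one_lt_two
  have hbin : binEntropy ε ≤ log 2 := binEntropy_le_log_two
  have hbin0 : 0 ≤ binEntropy ε := binEntropy_nonneg h0.le (by linarith)
  have hκ0 : 0 ≤ κ := by linarith
  have hγ0 : 0 ≤ γ := div_nonneg (by linarith) (by linarith)
  have hγ1 : γ * (1 - lam) = κ + η := div_mul_cancel₀ _ (by linarith)
  obtain ⟨N₁, hN₁⟩ := exists_nat_gt
    (max (max ((γ * (1 + N₀) + log 2) / η) ((1 + N₀) / (1 - lam))) N₀)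
  simp only [max_lt_iff] at hN₁
  refine ⟨N₁ * log 2, fun L N => ?_⟩
  induction N using Nat.strong_induction_on with
  | _ N ih =>
  intro hNL hmL
  by_cases hN : N ≤ N₁
  · refine ⟨fun _ => N * log 2, integrable_const _, fun z => MRSCode.fresh_le_const N k z, ?_⟩
    have : (N : ℝ) ≤ N₁ := by exact_mod_cast hN
    simp only [integral_const, probReal_univ, one_smul]
    nlinarith [mul_nonneg hγ0 (Nat.cast_nonneg (α := ℝ) N)]
  have hNN : (N₁ : ℝ) < N := by exact_mod_cast not_le.1 hN
  have hNη : γ * (1 + N₀) + log 2 < η * N := by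
    have := (div_lt_iff₀ hη).1 (hN₁.1.1.trans hNN); linarith
  have hNlam : 1 + N₀ < N * (1 - lam) := (div_lt_iff₀ (by linarith)).1 (hN₁.1.2.trans hNN)
  have hN0 : N₀ ≤ N := by exact_mod_cast (hN₁.2.trans hNN).le
  set N' := max N₀ ⌈lam * N⌉₊ with hN'
  have hN'1 : (N' : ℝ) ≤ lam * N + 1 + N₀ := by
    have h2 := (Nat.ceil_lt_add_one (mul_nonneg hlam0 (Nat.cast_nonneg (α := ℝ) N))).le
    have h3 : (0 : ℝ) ≤ lam * N := mul_nonneg hlam0 (Nat.cast_nonneg N)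
    rw [hN', Nat.cast_max]
    exact max_le (by linarith) (by linarith [Nat.cast_nonneg (α := ℝ) N₀])
  have hN'2 : N' < N := by
    have : (N' : ℝ) < N := by nlinarith
    exact_mod_cast this
  set l := ⌊ρ * N⌋₊ with hl
  have hlm : l ≤ m N' := by
    rw [hmN N' (le_max_left _ _)]
    refine Nat.floor_le_floor ?_
    have h2 : lam * N ≤ N' := (Nat.le_ceil _).trans (by exact_mod_cast le_max_right _ _)
    rw [← hlam]
    nlinarith
  have hlL : l ≤ L := hlm.trans ((hm hN'2.le).trans hmL)
  have hlN : (l : ℝ) ≤ ρ * N := Nat.floor_le (by positivity)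
  have hlN' : ρ * N < l + 1 := Nat.lt_floor_add_one _
  obtain ⟨B, hB, hBle, hBint⟩ := ih N' hN'2 (hN'2.le.trans hNL) ((hm hN'2.le).trans hmL)
  have hbud := C.integral_budget_le (c := c) h0 h1 k (N := N) (l := l) fun i hi =>
    hdec N hN0 i (by
      have : (i : ℝ) + 1 ≤ l := by exact_mod_cast hi
      linarith)
  have hsub : Integrable (fun z => C.budget ε k N l z - l * log 2) (C.law.prod (erasureLaw c)) :=
    (C.integrable_budget k N l).sub (integrable_const _)
  refine ⟨fun z => B z + (C.budget ε k N l z - l * log 2), hB.add hsub, fun z => ?_, ?_⟩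
  · have := MRSCode.fresh_le (C := C) hm hN'2.le hNL hlm hlL k h0 (by linarith) z
    have := hBle z
    unfold MRSCode.budget
    linarith
  · rw [integral_add hB hsub, integral_sub (C.integrable_budget k N l) (integrable_const _)]
    simp only [integral_const, probReal_univ, one_smul]
    have h3 : γ * N' ≤ γ * (lam * N + 1 + N₀) := mul_le_mul_of_nonneg_left hN'1 hγ0
    have h4 : (ρ * N - 1) * (log 2 - binEntropy ε) ≤ l * (log 2 - binEntropy ε) :=
      mul_le_mul_of_nonneg_right (by linarith) (by linarith)
    have h5 : γ * (1 - lam) * N = (κ + η) * N := by rw [hγ1]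
    rw [hκ] at h5
    nlinarith

/-- The converse for a fixed code that tolerates the error probability `ε`. -/
lemma MRSCode.rate_bounds {ρ₀ : ℝ} {ρ : Fin d → ℝ} (h0 : 0 < ε) (h1 : ε ≤ 1 / 2)
    (hadm : ∀ k, C.Admissible ε (ρ k) (onlyCapacity c k)) :
    (∀ k, max (ρ k - ε) 0 * (log 2 - binEntropy ε) ≤ c k * log 2) ∧
    (C.Admissible ε ρ₀ c → 0 < ρ₀ - ε → (∀ k, max (ρ k - ε) 0 < ρ₀ - ε) →
      (ρ₀ - ε) * (log 2 - binEntropy ε) ≤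
        ∑ k, (c k * log 2 - max (ρ k - ε) 0 * (log 2 - binEntropy ε) + ε) /
          (1 - max (ρ k - ε) 0 / (ρ₀ - ε))) := by
  have hbin : binEntropy ε ≤ log 2 := binEntropy_le_log_two
  have hdec : ∀ k, ∃ N₀ : ℕ, ∀ N, N₀ ≤ N → ∀ i : ℕ, (i : ℝ) + 1 ≤ N * max (ρ k - ε) 0 →
      C.errorProb (onlyCapacity c k) N i ≤ ε := by
    intro k
    obtain ⟨N₀, h⟩ := hadm k
    refine ⟨N₀, fun N hN i hi => h N hN i ?_⟩
    rcases le_total (ρ k - ε) 0 with h2 | h2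
    · rw [max_eq_right h2] at hi
      have := Nat.cast_nonneg (α := ℝ) i
      linarith
    · rwa [max_eq_left h2] at hi
  choose Nk hNk using hdec
  have hrate : ∀ k, max (ρ k - ε) 0 * (log 2 - binEntropy ε) ≤ c k * log 2 := by
    intro k
    refine le_of_forall_nat_mul_le (K := log 2 - binEntropy ε) (Nk k) fun N hN => ?_
    have hr : 0 ≤ max (ρ k - ε) 0 := le_max_right _ _
    set r := max (ρ k - ε) 0
    have hl : (⌊r * N⌋₊ : ℝ) ≤ r * N := Nat.floor_le (by positivity)
    have hl' : r * N < ⌊r * N⌋₊ + 1 := Nat.lt_floor_add_one _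
    have := C.bits_le_capacity (c := c) h0 h1 k (N := N) (l := ⌊r * N⌋₊) fun i hi =>
      hNk k N hN i (by
        have : (i : ℝ) + 1 ≤ ⌊r * N⌋₊ := by exact_mod_cast hi
        linarith)
    nlinarith
  refine ⟨hrate, fun hadm0 hρ0 hlt => ?_⟩
  obtain ⟨N0, hN0⟩ := hadm0
  set R := ρ₀ - ε with hR
  set N₀ := max N0 (univ.sup Nk) with hN₀
  have hNk' : ∀ k, Nk k ≤ N₀ := fun k => (le_sup (f := Nk) (mem_univ k)).trans (le_max_right _ _)
  -- Receiver `0` counts as having decoded nothing before the time `N₀`.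
  set m : ℕ → ℕ := fun n => if n < N₀ then 0 else ⌊R * n⌋₊ with hmdef
  have hm : Monotone m := by
    intro a b hab
    simp only [hmdef]
    split_ifs with ha hb hb
    · exact le_rfl
    · exact Nat.zero_le _
    · omega
    · have : (a : ℝ) ≤ b := by exact_mod_cast hab
      exact Nat.floor_le_floor (mul_le_mul_of_nonneg_left this hρ0.le)
  have m0 : m 0 = 0 := by simp [hmdef]
  have hmN : ∀ n, N₀ ≤ n → m n = ⌊R * n⌋₊ := fun n hn => if_neg (not_lt.2 hn)
  have hfresh := fun k => MRSCode.exists_fresh_le (C := C) (c := c) h0 h1 k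
    (lam := max (ρ k - ε) 0 / R) (le_max_right _ _) h0
    (div_nonneg (le_max_right _ _) hρ0.le) ((div_lt_one hρ0).2 (hlt k))
    (div_mul_cancel₀ _ hρ0.ne') hρ0 (fun N hN => hNk k N ((hNk' k).trans hN)) (hrate k) hm hmN
  choose K hK using hfresh
  refine le_of_forall_nat_mul_le (K := ∑ k, K k + (log 2 - binEntropy ε)) N₀ fun N hN => ?_
  choose B hB hBle hBint using fun k => hK k (max N (m N)) N (le_max_left _ _) (le_max_right _ _)
  have hint : ∀ n i, Integrable (fun z => fano ε (C.errAt z n i)) (C.law.prod (erasureLaw c)) :=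
    fun n i => (integral_fano (C.integrable_errAt c n i) ε).1
  have hF : Integrable (fun z => ∑ n ∈ range N, ∑ i ∈ Ico (m n) (m (n + 1)),
      fano ε (C.errAt z (n + 1) i)) (C.law.prod (erasureLaw c)) :=
    integrable_finsetSum _ fun n _ => integrable_finsetSum _ fun i _ => hint _ _
  have hS : Integrable (fun z => ∑ k, B k z) (C.law.prod (erasureLaw c)) :=
    integrable_finsetSum _ fun k _ => hB k
  have hmain : ∫ _z, m N * log 2 ∂(C.law.prod (erasureLaw c)) ≤
      ∫ z, (∑ k, B k z + ∑ n ∈ range N, ∑ i ∈ Ico (m n) (m (n + 1)),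
        fano ε (C.errAt z (n + 1) i)) ∂(C.law.prod (erasureLaw c)) := by
    refine integral_mono (integrable_const _) (hS.add hF) fun z => ?_
    refine (MRSCode.le_sum_fresh (C := C) m0 hm (le_max_left N (m N)) (le_max_right _ _) h0
      (by linarith) z).trans ?_
    exact add_le_add (sum_le_sum fun k _ => hBle k z) le_rfl
  have hFano : ∫ z, ∑ n ∈ range N, ∑ i ∈ Ico (m n) (m (n + 1)), fano ε (C.errAt z (n + 1) i)
      ∂(C.law.prod (erasureLaw c)) ≤ m N * binEntropy ε := by
    rw [integral_finsetSum _ fun n _ => integrable_finsetSum _ fun i _ => hint _ _]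
    have h2 : ∀ n ∈ range N, ∫ z, ∑ i ∈ Ico (m n) (m (n + 1)), fano ε (C.errAt z (n + 1) i)
        ∂(C.law.prod (erasureLaw c)) ≤ ((m (n + 1) : ℝ) - m n) * binEntropy ε := by
      intro n _
      rw [integral_finsetSum _ fun i _ => hint _ _]
      refine (sum_le_sum (g := fun _ => binEntropy ε) fun i hi => ?_).trans_eq ?_
      · rw [(integral_fano (C.integrable_errAt c (n + 1) i) ε).2, (C.integral_errAt c (n + 1) i).2]
        refine fano_le h0 h1 ?_
        have hi' : i < m (n + 1) := (mem_Ico.1 hi).2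
        have hn : N₀ ≤ n + 1 := by
          by_contra! hn
          simp [hmdef, hn] at hi'
        refine hN0 (n + 1) ((le_max_left _ _).trans hn) i ?_
        rw [hmN _ hn] at hi'
        have h3 : ((i + 1 : ℕ) : ℝ) ≤ R * ((n + 1 : ℕ) : ℝ) :=
          (Nat.le_floor_iff (by positivity)).1 hi'
        push_cast at h3 ⊢
        linarith
      · rw [sum_const, Nat.card_Ico, nsmul_eq_mul, Nat.cast_sub (hm n.le_succ)]
    refine (sum_le_sum h2).trans_eq ?_
    rw [← sum_mul, sum_range_sub (fun n => (m n : ℝ)), m0]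
    simp
  rw [integral_add hS hF, integral_finsetSum _ fun k _ => hB k] at hmain
  simp only [integral_const, probReal_univ, one_smul] at hmain
  have hsum := sum_le_sum fun k (_ : k ∈ univ) => hBint k
  rw [sum_add_distrib, ← sum_mul] at hsum
  have hmR : R * N < m N + 1 := by rw [hmN N hN]; exact Nat.lt_floor_add_one _
  have h4 : (R * N - 1) * (log 2 - binEntropy ε) ≤ m N * (log 2 - binEntropy ε) :=
    mul_le_mul_of_nonneg_right (by linarith) (by linarith)
  linarith

end Converse

/-! ### The converse for the network -/

section ConverseRegion

open Finset Real Filter Topology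

variable {d : ℕ} {w r : Fin d → ℝ} {s r₀ : ℝ}

lemma coe_capacityAll (hw : ∀ k, 0 ≤ w k) (hs : 0 < s) (hws : ∀ k, w k ≤ s) (k : Fin d) :
    (capacityAll w s k : ℝ) = w k / s := by
  rw [capacityAll, Set.coe_projIcc, min_eq_right ((div_le_one hs).2 (hws k)),
    max_eq_right (div_nonneg (hw k) hs.le)]

/-- The converse in the limit `ε → 0`. -/
lemma bounds_of_mem_achievableRegion (hd : 1 ≤ d) (hw : ∀ k, 0 ≤ w k) (hs : 0 < s)
    (hws : ∀ k, w k ≤ s) (h : (r₀, r) ∈ achievableRegion w s) :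
    (∀ k, r k ≤ w k) ∧ ((∀ k, w k < r₀) → 1 ≤ ∑ k, (w k - r k) / (r₀ - r k)) := by
  obtain ⟨hr₀, hr, hach⟩ := h
  simp only at hr₀ hr
  have hlog : 0 < log 2 := log_pos one_lt_two
  have hev : ∀ᶠ ε : ℝ in 𝓝[>] 0, 0 < ε ∧ ε ≤ 1 / 2 := by
    filter_upwards [Ioc_mem_nhdsGT (show (0 : ℝ) < 1 / 2 by norm_num)] with ε hε using hε
  have hbin : Continuous fun ε : ℝ => binEntropy ε := binEntropy_continuous
  have hcoe := coe_capacityAll hw hs hws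
  have hrs : ∀ k, 0 ≤ r k / s := fun k => div_nonneg (hr k) hs.le
  have hrate : ∀ k, r k ≤ w k := by
    intro k
    have h1 : Tendsto (fun ε : ℝ => max (r k / s - ε) 0 * (log 2 - binEntropy ε)) (𝓝[>] 0)
        (𝓝 (max (r k / s - 0) 0 * (log 2 - binEntropy 0))) :=
      (Continuous.tendsto (by fun_prop) 0).mono_left nhdsWithin_le_nhds
    have h2 := le_of_tendsto h1 (b := w k / s * log 2) (by
      filter_upwards [hev] with ε hε
      obtain ⟨C, hC⟩ := hach ε hε.1
      rw [← hcoe]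
      exact (MRSCode.rate_bounds (ρ₀ := 0) hε.1 hε.2 hC.2).1 k)
    simp only [sub_zero, binEntropy_zero, max_eq_left (hrs k)] at h2
    exact (div_le_div_iff_of_pos_right hs).1 (le_of_mul_le_mul_right h2 hlog)
  refine ⟨hrate, fun hlt => ?_⟩
  set k₀ : Fin d := ⟨0, hd⟩
  have hr₀pos : 0 < r₀ := (hw k₀).trans_lt (hlt k₀)
  have hρ : ∀ k, r k / s < r₀ / s := fun k =>
    (div_lt_div_iff_of_pos_right hs).2 ((hrate k).trans_lt (hlt k))
  have hρ₀ : 0 < r₀ / s := div_pos hr₀pos hs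
  have hden : ∀ k, 1 - r k / s / (r₀ / s) ≠ 0 := fun k =>
    (sub_pos.2 ((div_lt_one hρ₀).2 (hρ k))).ne'
  have h1 : Tendsto (fun ε : ℝ => (r₀ / s - ε) * (log 2 - binEntropy ε)) (𝓝[>] 0)
      (𝓝 ((r₀ / s - 0) * (log 2 - binEntropy 0))) :=
    (Continuous.tendsto (by fun_prop) 0).mono_left nhdsWithin_le_nhds
  have h2 : Tendsto (fun ε : ℝ => ∑ k, (w k / s * log 2 - max (r k / s - ε) 0 *
      (log 2 - binEntropy ε) + ε) / (1 - max (r k / s - ε) 0 / (r₀ / s - ε))) (𝓝[>] 0)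
      (𝓝 (∑ k, (w k / s * log 2 - max (r k / s - 0) 0 *
      (log 2 - binEntropy 0) + 0) / (1 - max (r k / s - 0) 0 / (r₀ / s - 0)))) := by
    refine tendsto_finsetSum _ fun k _ => Tendsto.mono_left ?_ nhdsWithin_le_nhds
    refine Tendsto.div (Continuous.tendsto (by fun_prop) 0) ?_ ?_
    · refine Tendsto.sub tendsto_const_nhds (Tendsto.div (Continuous.tendsto (by fun_prop) 0)
        (Continuous.tendsto (by fun_prop) 0) ?_)
      simpa using hρ₀.ne'
    · simpa [max_eq_left (hrs k)] using hden k
  have hlim : ∀ᶠ ε : ℝ in 𝓝[>] 0, 0 < r₀ / s - ε ∧ ∀ k, max (r k / s - ε) 0 < r₀ / s - ε := by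
    have h3 : ∀ᶠ ε : ℝ in 𝓝[>] 0, 0 < r₀ / s - ε := by
      filter_upwards [Ioo_mem_nhdsGT hρ₀] with ε hε
      linarith [hε.2]
    filter_upwards [h3] with ε hε
    exact ⟨hε, fun k => max_lt (by linarith [hρ k]) hε⟩
  have h3 := le_of_tendsto_of_tendsto h1 h2 (by
    filter_upwards [hev, hlim] with ε hε hl
    obtain ⟨C, hC⟩ := hach ε hε.1
    have := (MRSCode.rate_bounds (ρ₀ := r₀ / s) (ρ := fun k => r k / s) hε.1 hε.2 hC.2).2 hC.1
      hl.1 hl.2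
    simpa only [hcoe] using this)
  simp only [sub_zero, binEntropy_zero, add_zero, max_eq_left (hrs _)] at h3
  have h4 : ∀ k, (w k / s * log 2 - r k / s * log 2) / (1 - r k / s / (r₀ / s)) =
      (r₀ / s * log 2) * ((w k - r k) / (r₀ - r k)) := by
    intro k
    have hne : r₀ - r k ≠ 0 := (sub_pos.2 ((hrate k).trans_lt (hlt k))).ne'
    have h5 : 1 - r k / s / (r₀ / s) = (r₀ - r k) / r₀ := by
      field_simp
    rw [h5]
    field_simp
  rw [sum_congr rfl fun k _ => h4 k, ← mul_sum] at h3
  have h5 : 0 < r₀ / s * log 2 := by positivity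
  exact (le_mul_iff_one_le_right h5).1 h3

end ConverseRegion

/-! ### Superposition codes with two atoms -/

section TwoAtoms

open Real Set

/-- The parameter function of the random variable that is constantly `a`. -/
noncomputable def stepParam (a x : ℝ) : ℝ := if x ≤ a then a⁻¹ else 0

variable {a : ℝ}

lemma stepParam_nonneg (ha : 0 < a) (x : ℝ) : 0 ≤ stepParam a x := by
  unfold stepParam; split_ifs <;> positivity

lemma stepParam_le (ha : 0 < a) (x : ℝ) : stepParam a x ≤ a⁻¹ := by
  have : 0 < a⁻¹ := inv_pos.2 ha
  unfold stepParam; split_ifs <;> linarith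

lemma antitone_stepParam (ha : 0 < a) : Antitone (stepParam a) := by
  intro x y hxy
  have : 0 < a⁻¹ := inv_pos.2 ha
  unfold stepParam
  split_ifs <;> linarith

lemma measurable_stepParam (ha : 0 < a) : Measurable (stepParam a) :=
  (antitone_stepParam ha).measurable

lemma continuousWithinAt_stepParam (a α : ℝ) :
    ContinuousWithinAt (stepParam a) (Icc 0 α) α := by
  by_cases h : α ≤ a
  · refine (continuousWithinAt_const (b := a⁻¹)).congr (fun x hx => ?_) ?_
    · simp [stepParam, hx.2.trans h]
    · simp [stepParam, h]
  · refine ContinuousAt.continuousWithinAt ?_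
    refine (continuousAt_const (y := (0 : ℝ))).congr ?_
    filter_upwards [lt_mem_nhds (not_le.1 h)] with x hx
    simp [stepParam, not_le.2 hx]

lemma lintegral_stepParam (ha : 0 < a) :
    ∫⁻ x in Ici (0 : ℝ), ENNReal.ofReal (stepParam a x) = 1 := by
  have h : ∀ x, ENNReal.ofReal (stepParam a x) =
      (Iic a).indicator (fun _ => ENNReal.ofReal a⁻¹) x := by
    intro x
    by_cases hx : x ≤ a <;> simp [stepParam, hx]
  simp_rw [h]
  rw [lintegral_indicator measurableSet_Iic, lintegral_const, Measure.restrict_restrict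
    measurableSet_Iic, Measure.restrict_apply_univ, inter_comm, Ici_inter_Iic, Real.volume_Icc,
    ← ENNReal.ofReal_mul (inv_pos.2 ha).le, sub_zero, inv_mul_cancel₀ ha.ne', ENNReal.ofReal_one]

lemma parameterCDF_stepParam (ha : 0 < a) {α : ℝ} (hα : 0 ≤ α) :
    parameterCDF (stepParam a) α = if a < α then 1 else 0 := by
  have h1 : ∀ y, 0 ≤ y → y ≤ a → ∫ x in (0 : ℝ)..y, stepParam a x = y * a⁻¹ := by
    intro y hy hya
    have : EqOn (stepParam a) (fun _ => a⁻¹) (uIcc 0 y) := fun x hx => by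
      rw [uIcc_of_le hy] at hx
      simp [stepParam, hx.2.trans hya]
    rw [intervalIntegral.integral_congr this]
    simp
  unfold parameterCDF
  split_ifs with h
  · have h2 : ∫ x in a..α, stepParam a x = 0 := by
      have : ∫ x in a..α, stepParam a x = ∫ x in a..α, (0 : ℝ) := by
        refine intervalIntegral.integral_congr_ae (ae_of_all _ fun x hx => ?_)
        rw [uIoc_of_le h.le] at hx
        simp [stepParam, not_le.2 hx.1]
      simpa using this
    rw [← intervalIntegral.integral_add_adjacent_intervals
      (antitone_stepParam ha).intervalIntegrable (antitone_stepParam ha).intervalIntegrable (b := a),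
      h1 a ha.le le_rfl, h2]
    simp [stepParam, not_le.2 h, ha.ne']
  · rw [h1 α hα (not_lt.1 h)]
    simp [stepParam, not_lt.1 h]

/-- The superposition code with block size `K` in which Transmitter `k` draws the value `a k` with
probability `t k` and the value `b k` otherwise. -/
noncomputable def twoAtomData {d : ℕ} (K : ℕ) (hK : 0 < K) (a b : Fin d → ℝ) (ha : ∀ k, 0 < a k)
    (hb : ∀ k, 0 < b k) (t : Fin d → unitInterval) : SuperpositionData d where
  K := K
  K_pos := hK
  g k x := t k * stepParam (a k) x + (1 - t k) * stepParam (b k) x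
  g_nonneg k x _ := add_nonneg (mul_nonneg (t k).2.1 (stepParam_nonneg (ha k) x))
    (mul_nonneg (sub_nonneg.2 (t k).2.2) (stepParam_nonneg (hb k) x))
  g_bounded k := ⟨t k * (a k)⁻¹ + (1 - t k) * (b k)⁻¹, fun x _ =>
    add_le_add (mul_le_mul_of_nonneg_left (stepParam_le (ha k) x) (t k).2.1)
      (mul_le_mul_of_nonneg_left (stepParam_le (hb k) x) (sub_nonneg.2 (t k).2.2))⟩
  g_antitone k := fun _ _ _ _ hxy =>
    add_le_add (mul_le_mul_of_nonneg_left (antitone_stepParam (ha k) hxy) (t k).2.1)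
      (mul_le_mul_of_nonneg_left (antitone_stepParam (hb k) hxy) (sub_nonneg.2 (t k).2.2))
  g_leftCont k α _ := ((continuousWithinAt_stepParam (a k) α).const_mul _).add
    ((continuousWithinAt_stepParam (b k) α).const_mul _)
  g_integral k := by
    have h0 : 0 ≤ (t k : ℝ) := (t k).2.1
    have h1 : 0 ≤ 1 - (t k : ℝ) := sub_nonneg.2 (t k).2.2
    have h : ∀ x, ENNReal.ofReal (t k * stepParam (a k) x + (1 - t k) * stepParam (b k) x) =
        ENNReal.ofReal (t k) * ENNReal.ofReal (stepParam (a k) x) +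
          ENNReal.ofReal (1 - t k) * ENNReal.ofReal (stepParam (b k) x) := fun x => by
      rw [ENNReal.ofReal_add (mul_nonneg h0 (stepParam_nonneg (ha k) x))
        (mul_nonneg h1 (stepParam_nonneg (hb k) x)), ENNReal.ofReal_mul h0, ENNReal.ofReal_mul h1]
    simp_rw [h]
    have hma := (measurable_stepParam (ha k)).ennreal_ofReal
    have hmb := (measurable_stepParam (hb k)).ennreal_ofReal
    rw [lintegral_add_left (hma.const_mul _), lintegral_const_mul _ hma, lintegral_const_mul _ hmb,
      lintegral_stepParam (ha k), lintegral_stepParam (hb k), mul_one, mul_one,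
      ← ENNReal.ofReal_add h0 h1]
    simp
  lawA k := bernoulliMeasure (a k) (b k) (t k)
  lawA_isProbabilityMeasure k := inferInstance
  lawA_Iio k α hα := by
    have h1 : parameterCDF (fun x => t k * stepParam (a k) x + (1 - t k) * stepParam (b k) x) α =
        t k * parameterCDF (stepParam (a k)) α + (1 - t k) * parameterCDF (stepParam (b k)) α := by
      unfold parameterCDF
      rw [intervalIntegral.integral_add
        ((antitone_stepParam (ha k)).intervalIntegrable.const_mul _)
        ((antitone_stepParam (hb k)).intervalIntegrable.const_mul _),
        intervalIntegral.integral_const_mul, intervalIntegral.integral_const_mul]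
      ring
    rw [h1, parameterCDF_stepParam (ha k) hα, parameterCDF_stepParam (hb k) hα,
      bernoulliMeasure_real_apply _ measurableSet_Iio]
    by_cases h2 : a k < α <;> by_cases h3 : b k < α <;> simp [h2, h3]

end TwoAtoms

/-! ### Expectations of products of independent factors -/

section Products

open Real Finset

variable {ι : Type*} {X Y : ι → Type*} [∀ i, MeasurableSpace (X i)] [∀ i, MeasurableSpace (Y i)]
  (μ : ∀ i, Measure (X i)) [∀ i, IsProbabilityMeasure (μ i)]
  (ν : ∀ i, Measure (Y i)) [∀ i, IsProbabilityMeasure (ν i)]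

lemma integral_infinitePi_prod (s : Finset ι) {g : ∀ i, X i → ℝ} (hg : ∀ i, Measurable (g i)) :
    ∫ x, ∏ i ∈ s, g i (x i) ∂Measure.infinitePi μ = ∏ i ∈ s, ∫ x, g i x ∂μ i := by
  have h1 : AEStronglyMeasurable (fun y : ∀ i : s, X i => ∏ i : s, g i (y i))
      (Measure.pi fun i : s => μ i) :=
    Measurable.aestronglyMeasurable (by fun_prop)
  have h2 := integral_restrict_infinitePi (μ := μ) h1
  have h3 := integral_fintype_prod_eq_prod (𝕜 := ℝ) (fun i : s => g i) (μ := fun i : s => μ i)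
  rw [h3] at h2
  rw [← prod_coe_sort s fun i => ∫ x, g i x ∂μ i, ← h2]
  refine integral_congr_ae (ae_of_all _ fun x => ?_)
  exact (prod_coe_sort s fun i => g i (x i)).symm

/-- The same for two independent families, when the factors depend on the corresponding entries of
both. -/
lemma integral_infinitePi_prod_infinitePi (s : Finset ι) {f : ∀ i, X i × Y i → ℝ}
    (hf : ∀ i, Measurable (f i)) (B : ℝ) (hB : ∀ i x, |f i x| ≤ B) :
    Integrable (fun z : (∀ i, X i) × (∀ i, Y i) => ∏ i ∈ s, f i (z.1 i, z.2 i))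
      ((Measure.infinitePi μ).prod (Measure.infinitePi ν)) ∧
    ∫ z : (∀ i, X i) × (∀ i, Y i), ∏ i ∈ s, f i (z.1 i, z.2 i)
      ∂((Measure.infinitePi μ).prod (Measure.infinitePi ν)) =
      ∏ i ∈ s, ∫ x, ∫ y, f i (x, y) ∂ν i ∂μ i := by
  have hint : Integrable (fun z : (∀ i, X i) × (∀ i, Y i) => ∏ i ∈ s, f i (z.1 i, z.2 i))
      ((Measure.infinitePi μ).prod (Measure.infinitePi ν)) := by
    refine Integrable.of_bound (Measurable.aestronglyMeasurable ?_) (B ^ #s) (ae_of_all _ fun z => ?_)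
    · exact Finset.measurable_prod _ fun i _ => (hf i).comp (by fun_prop)
    · rw [norm_prod]
      exact (prod_le_prod (fun _ _ => norm_nonneg _) fun i _ => hB i _).trans_eq (by simp)
  refine ⟨hint, ?_⟩
  rw [integral_prod _ hint]
  have h1 : ∀ x : ∀ i, X i, ∫ y, ∏ i ∈ s, f i (x i, y i) ∂Measure.infinitePi ν =
      ∏ i ∈ s, ∫ y, f i (x i, y) ∂ν i := fun x =>
    integral_infinitePi_prod ν s fun i => (hf i).comp measurable_prodMk_left
  simp_rw [h1]
  exact integral_infinitePi_prod μ s fun i =>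
    ((hf i).stronglyMeasurable.integral_prod_right' (ν := ν i)).measurable

end Products

/-! ### Decoding a superposition code -/

section Decoder

open Real Finset

/-- The inner product modulo `2` of two bit vectors, written as a sign. -/
noncomputable def parityChar {K : ℕ} (u v : Fin K → Bool) : ℝ := ∏ j, if u j && v j then -1 else 1

lemma prod_sign_eq {ι : Type*} (s : Finset ι) (f : ι → Bool) :
    ∏ j ∈ s, (if f j then (-1 : ℝ) else 1) = if Nat.bodd (∑ j ∈ s, (f j).toNat) then -1 else 1 := by
  classical
  induction s using Finset.induction_on with
  | empty => simp
  | insert a s ha ih =>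
    rw [prod_insert ha, sum_insert ha, ih, Nat.bodd_add]
    cases f a <;> cases Nat.bodd (∑ j ∈ s, (f j).toNat) <;> simp

lemma parityChar_eq_or {K : ℕ} (u v : Fin K → Bool) : parityChar u v = 1 ∨ parityChar u v = -1 := by
  rw [parityChar, prod_sign_eq]
  split_ifs <;> simp

lemma parityChar_xor {K : ℕ} (u v x : Fin K → Bool) :
    parityChar u (fun j => xor (v j) (x j)) = parityChar u v * parityChar u x := by
  rw [parityChar, parityChar, parityChar, ← prod_mul_distrib]
  refine prod_congr rfl fun j _ => ?_
  cases u j <;> cases v j <;> cases x j <;> simp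

/-- The law of the coefficient vector of a random linear combination of `K` bits. -/
noncomputable def coeffLaw (K : ℕ) : Measure (Fin K → Bool) :=
  Measure.pi fun _ : Fin K => bernoulliMeasure true false ⟨1 / 2, by norm_num, by norm_num⟩

instance (K : ℕ) : IsProbabilityMeasure (coeffLaw K) := by
  unfold coeffLaw; infer_instance

/-- A random linear combination of a nonzero block is a fair bit. -/
lemma integral_parityChar {K : ℕ} {v : Fin K → Bool} (hv : ∃ j, v j = true) :
    ∫ u, parityChar u v ∂coeffLaw K = 0 := by
  unfold parityChar coeffLaw
  rw [integral_fintype_prod_eq_prod (𝕜 := ℝ) (fun j b => if b && v j then -1 else 1)]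
  obtain ⟨j, hj⟩ := hv
  refine prod_eq_zero (mem_univ j) ?_
  rw [integral_bernoulliMeasure, hj]
  norm_num

variable {d N K : ℕ}

/-- The block `v` agrees with all received symbols that come from the block with index `j`. Here `B`
lists the block index and the coefficient vector of each sent symbol. -/
def Consistent (B : Fin N × Fin d → ℕ × (Fin K → Bool)) (y : Fin N → Fin d → Option Bool) (j : ℕ)
    (v : Fin K → Bool) : Prop :=
  ∀ n k b, y n k = some b → (B (n, k)).1 = j → parityChar (B (n, k)).2 v = if b then -1 else 1

open scoped Classical in
/-- Decode a bit by choosing any block that agrees with the received symbols. -/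
noncomputable def decodeBit (hK : 0 < K) (B : Fin N × Fin d → ℕ × (Fin K → Bool))
    (y : Fin N → Fin d → Option Bool) (m : ℕ) : Bool :=
  if h : ∃ v, Consistent B y (m / K) v then h.choose ⟨m % K, Nat.mod_lt _ hK⟩ else false

namespace SuperpositionData

variable (S : SuperpositionData d)

/-- The part of the common randomness on which the symbols sent up to time `N` depend. -/
noncomputable def combination (N : ℕ) (q : S.Randomness) (x : Fin N × Fin d) : ℕ × (Fin S.K → Bool) :=
  (S.blockIndex q x.2 x.1, (q (x.1, x.2)).2)

lemma measurable_combination (N : ℕ) : Measurable (S.combination N) := by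
  refine measurable_pi_lambda _ fun x => Measurable.prodMk (S.measurable_blockIndex x.2 x.1) ?_
  fun_prop

/-- The superposition code with the data `S` and a decoder that serves every receiver, as it does not
depend on the capacities. -/
noncomputable def consistencyCode : MRSCode d :=
  S.code (fun q N y m => decodeBit S.K_pos (S.combination N q) y m) fun N y m =>
    (measurable_of_countable fun B => decodeBit S.K_pos B y m).comp (S.measurable_combination N)

lemma parityChar_eq_encode (q : S.Randomness) (M : ℕ → Bool) (k : Fin d) (n : ℕ) :
    parityChar (q (n, k)).2 (fun j => M (S.blockIndex q k n * S.K + j)) =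
      if S.encode q M k n then -1 else 1 := by
  rw [parityChar, prod_sign_eq, encode]

/-- A decoding error requires a nonzero vector that is annihilated by all unerased combinations of
the block. Whether there is one does not depend on the message. -/
lemma exists_ne_zero_of_error {q : S.Randomness} {M : ℕ → Bool} {e : ℕ × Fin d → Bool} {N m : ℕ}
    (h : M m ≠ decodeBit S.K_pos (S.combination N q) (received (S.encode q M) e N) m) :
    ∃ v : Fin S.K → Bool, (∃ j, v j = true) ∧ ∀ n < N, ∀ k, e (n, k) = false →
      S.blockIndex q k n = m / S.K → parityChar (q (n, k)).2 v = 1 := by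
  set x : Fin S.K → Bool := fun j => M (m / S.K * S.K + j) with hx
  have hcons : Consistent (S.combination N q) (received (S.encode q M) e N) (m / S.K) x := by
    intro n k b hb hj
    simp only [combination] at hj ⊢
    simp only [received] at hb
    split_ifs at hb
    rw [← Option.some.inj hb, ← S.parityChar_eq_encode, hj]
  have hex : ∃ v, Consistent (S.combination N q) (received (S.encode q M) e N) (m / S.K) v :=
    ⟨x, hcons⟩
  rw [decodeBit, dif_pos hex] at h
  refine ⟨fun j => xor (hex.choose j) (x j), ⟨⟨m % S.K, Nat.mod_lt _ S.K_pos⟩, ?_⟩, ?_⟩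
  · have hxm : x ⟨m % S.K, Nat.mod_lt _ S.K_pos⟩ = M m := by
      exact congrArg M (Nat.div_add_mod' m S.K)
    simp only [hxm, bne_iff_ne]
    exact h.symm
  · intro n hn k he hj
    have hy : received (S.encode q M) e N ⟨n, hn⟩ k = some (S.encode q M k n) := by
      simp [received, he]
    have h1 := hex.choose_spec ⟨n, hn⟩ k _ hy hj
    have h2 := hcons ⟨n, hn⟩ k _ hy hj
    simp only [combination] at h1 h2
    rw [parityChar_xor, h1, h2]
    split_ifs <;> norm_num

/-- The indicator that a symbol sent at time `n + 1` with the parameter `A` is a combination of the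
block with index `j`. -/
noncomputable def hit (n j : ℕ) (A : ℝ) : ℝ := if ⌈((n : ℝ) + 1) * A / S.K⌉₊ - 1 = j then 1 else 0

lemma measurable_hit (n j : ℕ) : Measurable (S.hit n j) := by
  have h : Measurable fun A : ℝ => ⌈((n : ℝ) + 1) * A / S.K⌉₊ :=
    Nat.measurable_ceil.comp (by fun_prop)
  exact (measurable_from_nat (f := fun a : ℕ => if a - 1 = j then (1 : ℝ) else 0)).comp h

lemma hit_nonneg (n j : ℕ) (A : ℝ) : 0 ≤ S.hit n j A := by unfold hit; split_ifs <;> norm_num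

lemma hit_le_one (n j : ℕ) (A : ℝ) : S.hit n j A ≤ 1 := by unfold hit; split_ifs <;> norm_num

/-- The indicator that a symbol is a combination of the block with index `j` and is not erased. -/
noncomputable def unerasedHit (n j : ℕ) (x : (ℝ × (Fin S.K → Bool)) × Bool) : ℝ :=
  if x.2 then 0 else S.hit n j x.1.1

lemma measurable_unerasedHit (n j : ℕ) : Measurable (S.unerasedHit n j) := by
  have := S.measurable_hit n j
  refine Measurable.ite ?_ measurable_const (by fun_prop)
  exact (measurableSet_singleton true).preimage measurable_snd

lemma unerasedHit_nonneg (n j : ℕ) (x) : 0 ≤ S.unerasedHit n j x := by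
  unfold unerasedHit; split_ifs; exacts [le_rfl, S.hit_nonneg _ _ _]

lemma unerasedHit_le_one (n j : ℕ) (x) : S.unerasedHit n j x ≤ 1 := by
  unfold unerasedHit; split_ifs; exacts [zero_le_one, S.hit_le_one _ _ _]

/-- The factor of a symbol in the moment generating function of the number of unerased
combinations, at `-θ`. -/
noncomputable def countFactor (θ : ℝ) (n j : ℕ) (x : (ℝ × (Fin S.K → Bool)) × Bool) : ℝ :=
  1 - S.unerasedHit n j x * (1 - exp (-θ))

/-- The factor of a symbol in the product that doubles with each unerased combination annihilating
`v`, and vanishes if some unerased combination does not annihilate `v`. It has mean `1` for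
`v ≠ 0`. -/
noncomputable def killFactor (v : Fin S.K → Bool) (n j : ℕ)
    (x : (ℝ × (Fin S.K → Bool)) × Bool) : ℝ :=
  1 + S.unerasedHit n j x * parityChar x.1.2 v

lemma measurable_countFactor (θ : ℝ) (n j : ℕ) : Measurable (S.countFactor θ n j) := by
  have := S.measurable_unerasedHit n j
  unfold countFactor
  fun_prop

lemma measurable_parityChar {K : ℕ} (v : Fin K → Bool) : Measurable fun u => parityChar u v :=
  measurable_of_finite _

lemma measurable_killFactor (v : Fin S.K → Bool) (n j : ℕ) : Measurable (S.killFactor v n j) := by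
  have := S.measurable_unerasedHit n j
  have := measurable_parityChar v
  unfold killFactor
  fun_prop

lemma countFactor_nonneg {θ : ℝ} (hθ : 0 ≤ θ) (n j : ℕ) (x) : 0 ≤ S.countFactor θ n j x := by
  have h1 := S.unerasedHit_nonneg n j x
  have h2 := S.unerasedHit_le_one n j x
  have h3 : exp (-θ) ≤ 1 := exp_le_one_iff.2 (by linarith)
  have h4 := exp_pos (-θ)
  unfold countFactor
  nlinarith

lemma countFactor_le {θ : ℝ} (hθ : 0 ≤ θ) (n j : ℕ) (x) : S.countFactor θ n j x ≤ 2 := by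
  have h1 := S.unerasedHit_nonneg n j x
  have h3 : exp (-θ) ≤ 1 := exp_le_one_iff.2 (by linarith)
  unfold countFactor
  nlinarith

lemma killFactor_nonneg (v : Fin S.K → Bool) (n j : ℕ) (x) : 0 ≤ S.killFactor v n j x := by
  have h1 := S.unerasedHit_nonneg n j x
  have h2 := S.unerasedHit_le_one n j x
  unfold killFactor
  rcases parityChar_eq_or x.1.2 v with h | h <;> rw [h] <;> linarith

lemma killFactor_le (v : Fin S.K → Bool) (n j : ℕ) (x) : S.killFactor v n j x ≤ 2 := by
  have h1 := S.unerasedHit_nonneg n j x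
  have h2 := S.unerasedHit_le_one n j x
  unfold killFactor
  rcases parityChar_eq_or x.1.2 v with h | h <;> rw [h] <;> linarith

variable (c : Fin d → unitInterval)

lemma integral_countFactor (θ : ℝ) (n j : ℕ) (k : Fin d) :
    ∫ x, ∫ y, S.countFactor θ n j (x, y) ∂(bernoulliMeasure true false (unitInterval.symm (c k)))
      ∂((S.lawA k).prod (coeffLaw S.K)) =
      1 - c k * (∫ A, S.hit n j A ∂S.lawA k) * (1 - exp (-θ)) := by
  have hint : Integrable (S.hit n j) (S.lawA k) :=
    Integrable.of_bound (S.measurable_hit n j).aestronglyMeasurable 1 (ae_of_all _ fun A => by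
      rw [norm_of_nonneg (S.hit_nonneg _ _ _)]; exact S.hit_le_one _ _ _)
  have h : ∀ x : ℝ × (Fin S.K → Bool), ∫ y, S.countFactor θ n j (x, y)
      ∂(bernoulliMeasure true false (unitInterval.symm (c k))) =
      1 - c k * (1 - exp (-θ)) * S.hit n j x.1 := fun x => by
    rw [integral_bernoulliMeasure]
    simp [countFactor, unerasedHit]
    ring
  simp_rw [h]
  rw [integral_fun_fst (fun A => 1 - c k * (1 - exp (-θ)) * S.hit n j A),
    integral_sub (integrable_const _) (hint.const_mul _), integral_const_mul]
  simp
  ring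

lemma integral_killFactor {v : Fin S.K → Bool} (hv : ∃ j, v j = true) (n j : ℕ) (k : Fin d) :
    ∫ x, ∫ y, S.killFactor v n j (x, y) ∂(bernoulliMeasure true false (unitInterval.symm (c k)))
      ∂((S.lawA k).prod (coeffLaw S.K)) = 1 := by
  have hint : Integrable (S.hit n j) (S.lawA k) :=
    Integrable.of_bound (S.measurable_hit n j).aestronglyMeasurable 1 (ae_of_all _ fun A => by
      rw [norm_of_nonneg (S.hit_nonneg _ _ _)]; exact S.hit_le_one _ _ _)
  have h : ∀ x : ℝ × (Fin S.K → Bool), ∫ y, S.killFactor v n j (x, y)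
      ∂(bernoulliMeasure true false (unitInterval.symm (c k))) =
      1 + (c k * S.hit n j x.1) * parityChar x.2 v := fun x => by
    rw [integral_bernoulliMeasure]
    simp [killFactor, unerasedHit]
    ring
  simp_rw [h]
  have hχ : Integrable (fun u => parityChar u v) (coeffLaw S.K) :=
    Integrable.of_bound (measurable_parityChar v).aestronglyMeasurable 1 (ae_of_all _ fun u => by
      rcases parityChar_eq_or u v with h | h <;> simp [h])
  rw [integral_add (integrable_const _) ((hint.const_mul _).mul_prod hχ),
    integral_prod_mul (fun A => c k * S.hit n j A) (fun u => parityChar u v), integral_parityChar hv]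
  simp

end SuperpositionData

end Decoder

/-! ### The error probability of a superposition code -/

section ErrorBound

open Real Finset

variable {d : ℕ} (S : SuperpositionData d)

namespace SuperpositionData

lemma unerasedHit_eq_or (n j : ℕ) (x) : S.unerasedHit n j x = 0 ∨ S.unerasedHit n j x = 1 := by
  unfold unerasedHit hit; split_ifs <;> simp

lemma countFactor_eq (θ : ℝ) (n j : ℕ) (x) :
    S.countFactor θ n j x = exp (-θ * S.unerasedHit n j x) := by
  unfold countFactor
  rcases S.unerasedHit_eq_or n j x with h | h <;> simp [h]

open scoped Classical in
/-- A function that is at least `1` wherever an error can occur: the first summand if at most `T`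
unerased combinations arrive, the second one if more arrive and all annihilate some nonzero
vector. -/
noncomputable def errorBound (θ T : ℝ) (N j : ℕ) (z : S.Randomness × (ℕ × Fin d → Bool)) : ℝ :=
  exp (θ * T) * ∏ i ∈ range N ×ˢ univ, S.countFactor θ i.1 j (z.1 i, z.2 i) +
    exp (-(T * log 2)) * ∑ v : Fin S.K → Bool with ∃ l, v l = true,
      ∏ i ∈ range N ×ˢ univ, S.killFactor v i.1 j (z.1 i, z.2 i)

lemma errorBound_nonneg {θ : ℝ} (hθ : 0 ≤ θ) (T : ℝ) (N j : ℕ) (z) :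
    0 ≤ S.errorBound θ T N j z :=
  add_nonneg (mul_nonneg (exp_pos _).le (prod_nonneg fun _ _ => S.countFactor_nonneg hθ _ _ _))
    (mul_nonneg (exp_pos _).le (sum_nonneg fun _ _ => prod_nonneg fun _ _ =>
      S.killFactor_nonneg _ _ _ _))

lemma one_le_errorBound {θ : ℝ} (hθ : 0 ≤ θ) (T : ℝ) {N j : ℕ}
    {z : S.Randomness × (ℕ × Fin d → Bool)} {v : Fin S.K → Bool} (hv : ∃ l, v l = true)
    (hkill : ∀ n < N, ∀ k, z.2 (n, k) = false → S.blockIndex z.1 k n = j →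
      parityChar (z.1 (n, k)).2 v = 1) :
    1 ≤ S.errorBound θ T N j z := by
  classical
  set h : ℝ := ∑ i ∈ range N ×ˢ (univ : Finset (Fin d)), S.unerasedHit i.1 j (z.1 i, z.2 i) with hh
  have h1 : ∏ i ∈ range N ×ˢ (univ : Finset (Fin d)), S.countFactor θ i.1 j (z.1 i, z.2 i) =
      exp (-θ * h) := by
    rw [hh, mul_sum, exp_sum]
    exact prod_congr rfl fun i _ => S.countFactor_eq _ _ _ _
  have h2 : ∏ i ∈ range N ×ˢ (univ : Finset (Fin d)), S.killFactor v i.1 j (z.1 i, z.2 i) =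
      exp (log 2 * h) := by
    rw [hh, mul_sum, exp_sum]
    refine prod_congr rfl fun i hi => ?_
    unfold killFactor
    rcases S.unerasedHit_eq_or i.1 j (z.1 i, z.2 i) with h0 | h0
    · simp [h0]
    · have h3 : parityChar (z.1 i).2 v = 1 := by
        unfold unerasedHit hit at h0
        split_ifs at h0 with he hb
        · simp at h0
        · exact hkill i.1 (mem_range.1 (mem_product.1 hi).1) i.2 (by simpa using he) hb
        · simp at h0
      rw [h0, h3, mul_one, mul_one, exp_log two_pos]
      norm_num
  have hA : 0 ≤ exp (θ * T) * ∏ i ∈ range N ×ˢ univ, S.countFactor θ i.1 j (z.1 i, z.2 i) :=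
    mul_nonneg (exp_pos _).le (prod_nonneg fun _ _ => S.countFactor_nonneg hθ _ _ _)
  have hB : exp (-(T * log 2)) * exp (log 2 * h) ≤ exp (-(T * log 2)) *
      ∑ v : Fin S.K → Bool with ∃ l, v l = true,
        ∏ i ∈ range N ×ˢ univ, S.killFactor v i.1 j (z.1 i, z.2 i) := by
    rw [← h2]
    refine mul_le_mul_of_nonneg_left ?_ (exp_pos _).le
    exact single_le_sum (f := fun v => ∏ i ∈ range N ×ˢ (univ : Finset (Fin d)),
      S.killFactor v i.1 j (z.1 i, z.2 i))
      (fun _ _ => prod_nonneg fun _ _ => S.killFactor_nonneg _ _ _ _) (by simpa using hv)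
  have hlog : 0 < log 2 := log_pos one_lt_two
  unfold errorBound
  rcases le_total h T with hT | hT
  · have h3 : 1 ≤ exp (θ * T) * exp (-θ * h) := by
      rw [← exp_add]; exact one_le_exp (by nlinarith)
    rw [h1]
    linarith [(mul_pos (exp_pos (-(T * log 2))) (exp_pos (log 2 * h)))]
  · have h3 : 1 ≤ exp (-(T * log 2)) * exp (log 2 * h) := by
      rw [← exp_add]; exact one_le_exp (by nlinarith)
    linarith

lemma integral_errorBound (c : Fin d → unitInterval) {θ : ℝ} (hθ : 0 ≤ θ) (T : ℝ) (N j : ℕ) :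
    Integrable (S.errorBound θ T N j) (S.randomnessLaw.prod (erasureLaw c)) ∧
    ∫ z, S.errorBound θ T N j z ∂(S.randomnessLaw.prod (erasureLaw c)) ≤
      exp (θ * T) * ∏ i ∈ range N ×ˢ univ,
        (1 - c i.2 * (∫ A, S.hit i.1 j A ∂S.lawA i.2) * (1 - exp (-θ))) +
      exp (-(T * log 2)) * 2 ^ S.K := by
  classical
  have h1 := integral_infinitePi_prod_infinitePi
    (fun p : ℕ × Fin d => (S.lawA p.2).prod (coeffLaw S.K))
    (fun p : ℕ × Fin d => bernoulliMeasure true false (unitInterval.symm (c p.2)))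
    (range N ×ˢ univ) (f := fun i => S.countFactor θ i.1 j)
    (fun i => S.measurable_countFactor θ i.1 j) 2 (fun i x => by
      rw [abs_of_nonneg (S.countFactor_nonneg hθ _ _ _)]; exact S.countFactor_le hθ _ _ _)
  have h2 := fun v => integral_infinitePi_prod_infinitePi
    (fun p : ℕ × Fin d => (S.lawA p.2).prod (coeffLaw S.K))
    (fun p : ℕ × Fin d => bernoulliMeasure true false (unitInterval.symm (c p.2)))
    (range N ×ˢ univ) (f := fun i => S.killFactor v i.1 j)
    (fun i => S.measurable_killFactor v i.1 j) 2 (fun i x => by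
      rw [abs_of_nonneg (S.killFactor_nonneg _ _ _ _)]; exact S.killFactor_le _ _ _ _)
  have h3 : Integrable (fun z : S.Randomness × (ℕ × Fin d → Bool) =>
      ∑ v : Fin S.K → Bool with ∃ l, v l = true,
        ∏ i ∈ range N ×ˢ univ, S.killFactor v i.1 j (z.1 i, z.2 i))
      (S.randomnessLaw.prod (erasureLaw c)) := integrable_finsetSum _ fun v _ => (h2 v).1
  have h4 : Integrable (fun z : S.Randomness × (ℕ × Fin d → Bool) =>
      ∏ i ∈ range N ×ˢ univ, S.countFactor θ i.1 j (z.1 i, z.2 i))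
      (S.randomnessLaw.prod (erasureLaw c)) := h1.1
  refine ⟨(h4.const_mul _).add (h3.const_mul _), ?_⟩
  unfold errorBound
  rw [integral_add (h4.const_mul _) (h3.const_mul _), integral_const_mul, integral_const_mul]
  refine add_le_add (mul_le_mul_of_nonneg_left ?_ (exp_pos _).le)
    (mul_le_mul_of_nonneg_left ?_ (exp_pos _).le)
  · refine h1.2.le.trans_eq (prod_congr rfl fun i _ => ?_)
    exact S.integral_countFactor c θ i.1 j i.2
  · refine (integral_finsetSum _ fun v _ => (h2 v).1).trans_le ?_
    refine (sum_le_sum (g := fun _ => (1 : ℝ)) fun v hv => ?_).trans ?_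
    · refine (h2 v).2.le.trans_eq (prod_eq_one fun i _ => ?_)
      exact S.integral_killFactor c (by simpa using hv) i.1 j i.2
    · rw [sum_const, nsmul_eq_mul, mul_one]
      have := card_filter_le (univ : Finset (Fin S.K → Bool)) (fun v => ∃ l, v l = true)
      simp only [card_univ, Fintype.card_fun, Fintype.card_bool, Fintype.card_fin] at this
      exact_mod_cast this

lemma errorProb_le_integral (c : Fin d → unitInterval) {θ : ℝ} (hθ : 0 ≤ θ) (T : ℝ) (N m : ℕ) :
    S.consistencyCode.errorProb c N m ≤
      ∫ z, S.errorBound θ T N (m / S.K) z ∂(S.randomnessLaw.prod (erasureLaw c)) := by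
  have hmap : (S.randomnessLaw.prod (messageLaw.prod (erasureLaw c))).map (Prod.map id Prod.snd) =
      S.randomnessLaw.prod (erasureLaw c) := by
    rw [← Measure.map_prod_map _ _ measurable_id measurable_snd, Measure.map_id,
      Measure.map_snd_prod, measure_univ, one_smul]
  have hint := (S.integral_errorBound c hθ T N (m / S.K)).1
  have hm := S.consistencyCode.measurableSet_error N m
  rw [← hmap] at hint ⊢
  have hφ : Measurable (Prod.map id Prod.snd :
      S.Randomness × ((ℕ → Bool) × (ℕ × Fin d → Bool)) → _) := measurable_id.prodMap measurable_snd
  rw [integral_map hφ.aemeasurable hint.aestronglyMeasurable, MRSCode.errorProb,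
    ← integral_indicator_one hm]
  refine integral_mono ((integrable_const 1).indicator hm) (hint.comp_measurable hφ) fun ω => ?_
  refine Set.indicator_le' (fun ω hω => ?_) (fun ω _ => S.errorBound_nonneg hθ _ _ _ _) ω
  obtain ⟨v, hv, hkill⟩ := S.exists_ne_zero_of_error hω
  exact S.one_le_errorBound hθ T hv hkill

/-- The error probability is exponentially small if the expected number `μ` of unerased combinations
of a block exceeds the threshold `T`, which in turn exceeds the block size. -/
lemma errorProb_le_exp (c : Fin d → unitInterval) {θ μ : ℝ} (hθ : 0 ≤ θ) (T : ℝ) (N m : ℕ)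
    (hμ : μ ≤ ∑ k, c k * ∑ n ∈ range N, ∫ A, S.hit n (m / S.K) A ∂S.lawA k) :
    S.consistencyCode.errorProb c N m ≤
      exp (θ * T - μ * (1 - exp (-θ))) + exp ((S.K - T) * log 2) := by
  refine (S.errorProb_le_integral c hθ T N m).trans
    ((S.integral_errorBound c hθ T N (m / S.K)).2.trans (add_le_add ?_ ?_))
  · rw [sub_eq_add_neg (θ * T), exp_add]
    refine mul_le_mul_of_nonneg_left ?_ (exp_pos _).le
    have h0 : 0 ≤ 1 - exp (-θ) := sub_nonneg.2 (exp_le_one_iff.2 (by linarith))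
    have h1 : ∀ i ∈ range N ×ˢ (univ : Finset (Fin d)),
        1 - c i.2 * (∫ A, S.hit i.1 (m / S.K) A ∂S.lawA i.2) * (1 - exp (-θ)) ≤
          exp (-(c i.2 * (∫ A, S.hit i.1 (m / S.K) A ∂S.lawA i.2) * (1 - exp (-θ)))) := fun i _ => by
      linarith [add_one_le_exp (-(c i.2 * (∫ A, S.hit i.1 (m / S.K) A ∂S.lawA i.2) * (1 - exp (-θ))))]
    have h2 : ∀ i ∈ range N ×ˢ (univ : Finset (Fin d)),
        0 ≤ 1 - c i.2 * (∫ A, S.hit i.1 (m / S.K) A ∂S.lawA i.2) * (1 - exp (-θ)) := fun i _ => by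
      have h3 : ∫ A, S.hit i.1 (m / S.K) A ∂S.lawA i.2 ≤ 1 := by
        refine (integral_mono_of_nonneg (ae_of_all _ fun A => S.hit_nonneg _ _ A)
          (integrable_const (1 : ℝ)) (ae_of_all _ fun A => S.hit_le_one _ _ A)).trans_eq (by simp)
      have h4 : 0 ≤ ∫ A, S.hit i.1 (m / S.K) A ∂S.lawA i.2 :=
        integral_nonneg fun A => S.hit_nonneg _ _ A
      have h5 : c i.2 * (∫ A, S.hit i.1 (m / S.K) A ∂S.lawA i.2) ≤ 1 :=
        mul_le_one₀ (c i.2).2.2 h4 h3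
      have h6 : 1 - exp (-θ) ≤ 1 := by linarith [exp_pos (-θ)]
      linarith [mul_le_one₀ h5 h0 h6]
    refine (prod_le_prod h2 h1).trans ?_
    rw [← exp_sum, exp_le_exp, sum_neg_distrib, neg_le_neg_iff, ← sum_mul]
    refine mul_le_mul_of_nonneg_right (hμ.trans_eq ?_) h0
    rw [sum_product_right]
    exact sum_congr rfl fun k _ => mul_sum _ _ _
  · refine le_of_eq ?_
    rw [show (2 : ℝ) ^ S.K = exp (S.K * log 2) by rw [mul_comm, exp_mul, exp_log two_pos, rpow_natCast],
      ← exp_add]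
    congr 1
    ring

end SuperpositionData

end ErrorBound

/-! ### Achievability -/

section Achievability

open Real Finset Filter Topology

variable {d : ℕ}

/-- With the constant parameter `a`, a block is used about `K / a` times. -/
lemma SuperpositionData.le_sum_hit (S : SuperpositionData d) {a ρ : ℝ} (ha : 0 < a) {N j : ℕ}
    (h : ((j : ℝ) + 1) * S.K ≤ ρ * N) :
    S.K * stepParam a ρ - 1 ≤ ∑ n ∈ range N, S.hit n j a := by
  have hnonneg : 0 ≤ ∑ n ∈ range N, S.hit n j a := sum_nonneg fun _ _ => S.hit_nonneg _ _ _
  have hK : (0 : ℝ) < S.K := by exact_mod_cast S.K_pos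
  by_cases hρ : ρ ≤ a
  swap
  · simp only [stepParam, if_neg hρ, mul_zero]; linarith
  set x : ℝ := j * S.K / a with hx
  set y : ℝ := ((j : ℝ) + 1) * S.K / a with hy
  have hx0 : 0 ≤ x := by positivity
  have hxy : y = x + S.K * a⁻¹ := by rw [hx, hy]; ring
  have hyN : y ≤ N := by
    rw [hy, div_le_iff₀ ha]
    nlinarith [Nat.cast_nonneg (α := ℝ) N]
  have hsub : Ico ⌊x⌋₊ ⌊y⌋₊ ⊆ range N := by
    intro n hn
    have : ⌊y⌋₊ ≤ N := Nat.floor_le_of_le hyN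
    have := (mem_Ico.1 hn).2
    exact mem_range.2 (by omega)
  have hone : ∀ n ∈ Ico ⌊x⌋₊ ⌊y⌋₊, S.hit n j a = 1 := by
    intro n hn
    have h1 : x < (n : ℝ) + 1 := by
      have := Nat.lt_of_floor_lt (Nat.lt_succ_of_le (mem_Ico.1 hn).1)
      push_cast at this
      exact this
    have h2 : (n : ℝ) + 1 ≤ y := by
      have := (Nat.le_floor_iff (hx0.trans (by rw [hxy]; linarith [mul_pos hK (inv_pos.2 ha)]))).1
        (Nat.succ_le_of_lt (mem_Ico.1 hn).2)
      push_cast at this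
      exact this
    have hceil : ⌈((n : ℝ) + 1) * a / S.K⌉₊ = j + 1 := by
      rw [Nat.ceil_eq_iff (by omega)]
      rw [hx, div_lt_iff₀ ha] at h1
      rw [hy, le_div_iff₀ ha] at h2
      push_cast
      refine ⟨?_, ?_⟩
      · rw [lt_div_iff₀ hK]; simpa using h1
      · rw [div_le_iff₀ hK]; exact h2
    simp [SuperpositionData.hit, hceil]
  have hcard : S.K * a⁻¹ - 1 ≤ ((Ico ⌊x⌋₊ ⌊y⌋₊).card : ℝ) := by
    have h1 := Nat.floor_le hx0
    have h2 := Nat.lt_floor_add_one y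
    have h3 : ⌊x⌋₊ ≤ ⌊y⌋₊ :=
      Nat.floor_le_floor (by rw [hxy]; linarith [mul_pos hK (inv_pos.2 ha)])
    rw [Nat.card_Ico, Nat.cast_sub h3]
    linarith
  rw [stepParam, if_pos hρ]
  refine hcard.trans ?_
  rw [← nsmul_one, ← sum_const]
  refine (sum_le_sum fun n hn => (hone n hn).ge).trans ?_
  exact sum_le_sum_of_subset_of_nonneg hsub fun _ _ _ => S.hit_nonneg _ _ _

section TwoAtoms

variable {a b : Fin d → ℝ} (ha : ∀ k, 0 < a k) (hb : ∀ k, 0 < b k) (t : Fin d → unitInterval)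

lemma le_sum_integral_hit {K : ℕ} (hK : 0 < K) (c : Fin d → unitInterval) {ρ : ℝ} {N j : ℕ}
    (h : ((j : ℝ) + 1) * K ≤ ρ * N) :
    K * (∑ k, c k * (t k * stepParam (a k) ρ + (1 - t k) * stepParam (b k) ρ)) - d ≤
      ∑ k, c k * ∑ n ∈ range N, ∫ A, (twoAtomData K hK a b ha hb t).hit n j A
        ∂(twoAtomData K hK a b ha hb t).lawA k := by
  have hd : (d : ℝ) = ∑ _k : Fin d, (1 : ℝ) := by simp
  rw [hd, mul_sum, ← sum_sub_distrib]
  refine sum_le_sum fun k _ => ?_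
  have h1 := (twoAtomData K hK a b ha hb t).le_sum_hit (ha k) h
  have h2 := (twoAtomData K hK a b ha hb t).le_sum_hit (hb k) h
  have h3 : ∀ n, ∫ A, (twoAtomData K hK a b ha hb t).hit n j A
      ∂(twoAtomData K hK a b ha hb t).lawA k =
      t k * (twoAtomData K hK a b ha hb t).hit n j (a k) +
        (1 - t k) * (twoAtomData K hK a b ha hb t).hit n j (b k) := fun n =>
    integral_bernoulliMeasure _ _ _ _
  simp_rw [h3]
  rw [sum_add_distrib, ← mul_sum, ← mul_sum]
  have ht0 : 0 ≤ (t k : ℝ) := (t k).2.1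
  have ht1 : 0 ≤ 1 - (t k : ℝ) := sub_nonneg.2 (t k).2.2
  have hc0 : 0 ≤ (c k : ℝ) := (c k).2.1
  have hc1 : (c k : ℝ) ≤ 1 := (c k).2.2
  have h4 := mul_le_mul_of_nonneg_left (add_le_add (mul_le_mul_of_nonneg_left h1 ht0)
    (mul_le_mul_of_nonneg_left h2 ht1)) hc0
  refine le_trans ?_ h4
  change (K : ℝ) * _ - 1 ≤ c k * (t k * (K * stepParam (a k) ρ - 1) +
    (1 - t k) * (K * stepParam (b k) ρ - 1))
  linarith

/-- If the combinations of a block arrive, in the mean, at more than the rate needed to determine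
it, then the error probability vanishes with growing block size. -/
lemma exists_blockSize (c : Fin d → unitInterval) {ρ ε : ℝ} (hε : 0 < ε)
    (hG : 1 < ∑ k, c k * (t k * stepParam (a k) ρ + (1 - t k) * stepParam (b k) ρ)) :
    ∃ K₀ : ℕ, ∀ K (hK : 0 < K), K₀ ≤ K → ∀ N m : ℕ, (((m / K : ℕ) : ℝ) + 1) * K ≤ ρ * N →
      (twoAtomData K hK a b ha hb t).consistencyCode.errorProb c N m ≤ ε := by
  set G := ∑ k, c k * (t k * stepParam (a k) ρ + (1 - t k) * stepParam (b k) ρ) with hGdef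
  have hlog : 0 < log 2 := log_pos one_lt_two
  -- The threshold is `K (1 + G) / 2`, between the block size `K` and the mean `K G`.
  set θ : ℝ := (G - 1) / (2 * (G + 1)) with hθ
  have hθ0 : 0 < θ := div_pos (by linarith) (by linarith)
  set α : ℝ := G * (1 - exp (-θ)) - θ * ((1 + G) / 2) with hα
  have hα0 : 0 < α := by
    have h1 : exp (-θ) ≤ (1 + θ)⁻¹ := by
      rw [exp_neg]
      exact inv_anti₀ (by linarith) (by linarith [add_one_le_exp θ])
    have h2 : (1 + θ)⁻¹ = 1 - θ / (1 + θ) := by field_simp; ring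
    have h3 : θ * ((1 + G) / 2) < G * (θ / (1 + θ)) := by
      have h4 : θ * (2 * (G + 1)) = G - 1 := div_mul_cancel₀ _ (by linarith)
      have h5 : (1 + G) / 2 * (1 + θ) < G := by linarith
      rw [← mul_div_assoc G, lt_div_iff₀ (by linarith)]
      linarith [mul_lt_mul_of_pos_left h5 hθ0]
    have h5 : G * (θ / (1 + θ)) ≤ G * (1 - exp (-θ)) :=
      mul_le_mul_of_nonneg_left (by linarith) (by linarith)
    linarith
  set β : ℝ := (G - 1) / 2 * log 2 with hβ
  have hβ0 : 0 < β := mul_pos (by linarith) hlog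
  have hlin : ∀ x > (0 : ℝ), ∀ y : ℝ, Tendsto (fun K : ℕ => exp (y - K * x)) atTop (𝓝 0) := by
    intro x hx y
    refine tendsto_exp_atBot.comp (tendsto_atBot_add_const_left _ y ?_)
    exact tendsto_neg_atTop_atBot.comp (tendsto_natCast_atTop_atTop.atTop_mul_const hx)
  have hlim := (hlin α hα0 (d * (1 - exp (-θ)))).add (hlin β hβ0 0)
  rw [add_zero] at hlim
  obtain ⟨K₀, hK₀⟩ := eventually_atTop.1 (hlim.eventually_le_const hε)
  refine ⟨K₀, fun K hK hKK N m h => ?_⟩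
  have h1 := (twoAtomData K hK a b ha hb t).errorProb_le_exp c hθ0.le (K * ((1 + G) / 2)) N m
    (le_sum_integral_hit ha hb t hK c h)
  refine (h1.trans_eq ?_).trans (hK₀ K hKK)
  congr 2
  · rw [hα]; ring
  · change ((K : ℝ) - _) * log 2 = _
    rw [hβ]; ring

end TwoAtoms

/-- Error bounds per block suffice for admissibility: the block of a bit within the rate `ρ - ε` ends
within the rate `ρ - ε / 2` once `N ≥ 2 K / ε`. -/
lemma admissible_of_errorProb_le {C : MRSCode d} {c : Fin d → unitInterval} {K : ℕ} {ρ ε : ℝ}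
    (hε : 0 < ε) (h : ε < ρ → ∀ N m : ℕ, (((m / K : ℕ) : ℝ) + 1) * K ≤ (ρ - ε / 2) * N →
      C.errorProb c N m ≤ ε) : C.Admissible ε ρ c := by
  obtain ⟨N₀, hN₀⟩ := exists_nat_gt (2 * K / ε)
  refine ⟨N₀, fun N hN m hm => ?_⟩
  have hNε : (2 * K : ℝ) ≤ N * ε := by
    have h1 : (N₀ : ℝ) ≤ N := by exact_mod_cast hN
    have h2 := (div_lt_iff₀ hε).1 hN₀
    nlinarith
  have hm0 : (0 : ℝ) < N * (ρ - ε) := lt_of_lt_of_le (by positivity) hm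
  have hρ : ε < ρ := by
    by_contra! hρ
    nlinarith [Nat.cast_nonneg (α := ℝ) N]
  refine h hρ N m ?_
  have h3 : ((m / K : ℕ) : ℝ) * K ≤ m := by exact_mod_cast Nat.div_mul_le_self m K
  linarith

/-- Atoms for the target rates: the step functions are just high enough at the target rates to supply
every receiver with one combination per bit. -/
lemma exists_atoms {c ρ : Fin d → ℝ} {ρ₀ : ℝ} (hc : ∀ k, 0 ≤ c k) (hρ : ∀ k, 0 ≤ ρ k)
    (hρc : ∀ k, ρ k ≤ c k)
    (h : (∃ k, ρ₀ ≤ c k) ∨ ((∀ k, c k < ρ₀) ∧ 1 ≤ ∑ k, (c k - ρ k) / (ρ₀ - ρ k))) :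
    ∃ (a b : Fin d → ℝ) (t : Fin d → unitInterval), (∀ k, 0 < a k) ∧ (∀ k, 0 < b k) ∧
      (∀ k, 0 < ρ k →
        1 ≤ c k * (t k * stepParam (a k) (ρ k) + (1 - t k) * stepParam (b k) (ρ k))) ∧
      (0 < ρ₀ → 1 ≤ ∑ k, c k * (t k * stepParam (a k) ρ₀ + (1 - t k) * stepParam (b k) ρ₀)) := by
  rcases h with ⟨k₀, hk₀⟩ | ⟨hlt, hsum⟩
  · -- Transmitter `k` always works at its own capacity.
    have ha : ∀ k, 0 < if 0 < c k then c k else 1 := fun k => by split_ifs <;> linarith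
    have key : ∀ k x, 0 < c k → x ≤ c k → c k * (((1 : unitInterval) : ℝ) *
        stepParam (if 0 < c k then c k else 1) x + (1 - ((1 : unitInterval) : ℝ)) *
        stepParam (if 0 < c k then c k else 1) x) = 1 := fun k x hk hx => by
      simp [stepParam, hk, hx, hk.ne']
    refine ⟨fun k => if 0 < c k then c k else 1, fun k => if 0 < c k then c k else 1, fun _ => 1,
      ha, ha, fun k hk => (key k _ (hk.trans_le (hρc k)) (hρc k)).ge, fun h0 => ?_⟩
    refine (key k₀ _ (h0.trans_le hk₀) hk₀).ge.trans ?_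
    refine single_le_sum (f := fun k => c k * (((1 : unitInterval) : ℝ) *
        stepParam (if 0 < c k then c k else 1) ρ₀ + (1 - ((1 : unitInterval) : ℝ)) *
        stepParam (if 0 < c k then c k else 1) ρ₀)) (fun k _ => ?_) (mem_univ k₀)
    simpa using mul_nonneg (hc k) (stepParam_nonneg (ha k) ρ₀)
  · -- The atoms are the own rate `ρ k`, and the rate `ρ₀` with probability `τ k`. The latter uses up
    -- the capacity that Receiver `k` leaves over.
    set τ : Fin d → ℝ := fun k =>
      if 0 < ρ k then (c k - ρ k) * ρ₀ / (c k * (ρ₀ - ρ k)) else 1 with hτ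
    have hden : ∀ k, 0 < ρ₀ - ρ k := fun k => sub_pos.2 ((hρc k).trans_lt (hlt k))
    have hρ₀ : ∀ k : Fin d, 0 < ρ₀ := fun k => (hc k).trans_lt (hlt k)
    have hτ0 : ∀ k, 0 ≤ τ k := fun k => by
      have h1 := hden k
      have h2 := hρ₀ k
      have h3 := hc k
      have h4 := sub_nonneg.2 (hρc k)
      simp only [hτ]
      split_ifs <;> positivity
    have hτ1 : ∀ k, τ k ≤ 1 := fun k => by
      simp only [hτ]
      split_ifs with hk
      · have h1 : 0 < c k := hk.trans_le (hρc k)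
        rw [div_le_one (mul_pos h1 (hden k))]
        nlinarith [hlt k]
      · exact le_rfl
    have ha : ∀ k, 0 < if 0 < ρ k then ρ k else 1 := fun k => by split_ifs <;> linarith
    refine ⟨fun k => if 0 < ρ k then ρ k else 1, fun k => ρ₀,
      fun k => ⟨1 - τ k, sub_nonneg.2 (hτ1 k), sub_le_self 1 (hτ0 k)⟩, ha, hρ₀, fun k hk => ?_,
      fun _ => hsum.trans (sum_le_sum fun k _ => ?_)⟩
    · have h1 : 0 < c k := hk.trans_le (hρc k)
      have h2 : ρ k ≤ ρ₀ := (sub_pos.1 (hden k)).le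
      simp only [stepParam, hτ, if_pos hk, if_pos h2, if_pos le_rfl]
      refine le_of_eq ?_
      have h3 := (hden k).ne'
      have h4 := (hρ₀ k).ne'
      field_simp
      ring
    · have h0 : 0 ≤ (1 - τ k) * stepParam (if 0 < ρ k then ρ k else 1) ρ₀ :=
        mul_nonneg (sub_nonneg.2 (hτ1 k)) (stepParam_nonneg (ha k) _)
      have h1 : (c k - ρ k) / (ρ₀ - ρ k) = c k * (τ k * ρ₀⁻¹) := by
        have h3 := (hden k).ne'
        have h4 := (hρ₀ k).ne'
        simp only [hτ]
        split_ifs with hk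
        · have h5 : c k ≠ 0 := (hk.trans_le (hρc k)).ne'
          field_simp
        · have h5 : ρ k = 0 := le_antisymm (not_lt.1 hk) (hρ k)
          simp [h5, div_eq_mul_inv]
      rw [h1]
      refine mul_le_mul_of_nonneg_left ?_ (hc k)
      have h2 : stepParam ρ₀ ρ₀ = ρ₀⁻¹ := if_pos le_rfl
      rw [h2]
      dsimp only
      linarith

/-- Moving an atom from `a` to `u * a` with `u < 1` raises the step function by the factor `1 / u`. -/
lemma stepParam_scale {a u x y : ℝ} (ha : 0 < a) (hu : 0 < u) (hxy : y ≤ u * x) :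
    u⁻¹ * stepParam a x ≤ stepParam (u * a) y := by
  by_cases hx : x ≤ a
  · have hy : y ≤ u * a := hxy.trans (mul_le_mul_of_nonneg_left hx hu.le)
    rw [stepParam, stepParam, if_pos hx, if_pos hy, mul_inv]
  · rw [stepParam, if_neg hx, mul_zero]
    exact stepParam_nonneg (mul_pos hu ha) y

end Achievability

/-! ### The region of the network is achievable -/

section Region

open Real Finset

variable {d : ℕ} {w r : Fin d → ℝ} {s r₀ : ℝ}

lemma superpositionRegion_subset (w : Fin d → ℝ) (s : ℝ) :
    superpositionRegion w s ⊆ achievableRegion w s := fun _ hp =>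
  ⟨hp.1, hp.2.1, fun ε hε => (hp.2.2 ε hε).imp fun _ hC => hC.2⟩

lemma mem_superpositionRegion (hw : ∀ k, 0 ≤ w k) (hs : 0 < s) (hws : ∀ k, w k ≤ s)
    (hr₀ : 0 ≤ r₀) (hr : ∀ k, 0 ≤ r k) (hrw : ∀ k, r k ≤ w k)
    (h : (∃ k, r₀ ≤ w k) ∨ ((∀ k, w k < r₀) ∧ 1 ≤ ∑ k, (w k - r k) / (r₀ - r k))) :
    (r₀, r) ∈ superpositionRegion w s := by
  refine ⟨hr₀, hr, fun ε hε => ?_⟩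
  have hcoe := coe_capacityAll hw hs hws
  set c := capacityAll w s with hc
  have hρ₀ : 0 ≤ r₀ / s := div_nonneg hr₀ hs.le
  have hρ1 : ∀ k, r k / s ≤ 1 := fun k => (div_le_one hs).2 ((hrw k).trans (hws k))
  obtain ⟨a, b, t, ha, hb, hone, hall⟩ := exists_atoms (c := fun k => (c k : ℝ))
    (ρ := fun k => r k / s) (ρ₀ := r₀ / s) (fun k => (c k).2.1) (fun k => div_nonneg (hr k) hs.le)
    (fun k => by rw [hcoe]; exact div_le_div_of_nonneg_right (hrw k) hs.le) (by
      refine h.imp (fun ⟨k, hk⟩ => ⟨k, ?_⟩) fun ⟨h1, h2⟩ => ⟨fun k => ?_, h2.trans_eq ?_⟩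
      · rw [hcoe]; exact div_le_div_of_nonneg_right hk hs.le
      · rw [hcoe]; exact div_lt_div_of_pos_right (h1 k) hs
      · refine sum_congr rfl fun k _ => ?_
        rw [hcoe, ← sub_div, ← sub_div, div_div_div_cancel_right₀ hs.ne'])
  -- Shrinking the atoms by the factor `u` costs at most `ε / 2` of each rate, and leaves every
  -- receiver with more than one combination per bit.
  set δ : ℝ := min (1 / 2) (ε / (2 * (1 + r₀ / s))) with hδ
  have hδ0 : 0 < δ := lt_min (by norm_num) (by positivity)
  have hδ1 : δ ≤ 1 / 2 := min_le_left _ _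
  have hδε : δ * (1 + r₀ / s) ≤ ε / 2 := by
    have h1 : δ ≤ ε / (2 * (1 + r₀ / s)) := min_le_right _ _
    rw [le_div_iff₀ (by positivity)] at h1
    linarith
  set u : ℝ := 1 - δ with hu
  have hu0 : 0 < u := by linarith
  have hu1 : 1 < u⁻¹ := (one_lt_inv₀ hu0).2 (by linarith)
  have hua : ∀ k, 0 < u * a k := fun k => mul_pos hu0 (ha k)
  have hub : ∀ k, 0 < u * b k := fun k => mul_pos hu0 (hb k)
  have hshift : ∀ x, x ≤ 1 ∨ x ≤ r₀ / s → x - ε / 2 ≤ u * x := by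
    intro x hx
    have : δ * x ≤ ε / 2 := by
      refine (mul_le_mul_of_nonneg_left ?_ hδ0.le).trans hδε
      rcases hx with hx | hx <;> linarith
    rw [hu]
    linarith
  have hscale : ∀ k x, (x ≤ 1 ∨ x ≤ r₀ / s) →
      u⁻¹ * (c k * (t k * stepParam (a k) x + (1 - t k) * stepParam (b k) x)) ≤
      c k * (t k * stepParam (u * a k) (x - ε / 2) +
        (1 - t k) * stepParam (u * b k) (x - ε / 2)) := by
    intro k x hx
    have h1 := mul_le_mul_of_nonneg_left (stepParam_scale (ha k) hu0 (hshift x hx)) (t k).2.1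
    have h2 := mul_le_mul_of_nonneg_left (stepParam_scale (hb k) hu0 (hshift x hx))
      (sub_nonneg.2 (t k).2.2)
    have h3 := mul_le_mul_of_nonneg_left (add_le_add h1 h2) (c k).2.1
    refine le_trans (le_of_eq ?_) h3
    ring
  have hK0 : ∃ K₀ : ℕ, ∀ K (hK : 0 < K), K₀ ≤ K → ε < r₀ / s → ∀ N m : ℕ,
      (((m / K : ℕ) : ℝ) + 1) * K ≤ (r₀ / s - ε / 2) * N →
      (twoAtomData K hK _ _ hua hub t).consistencyCode.errorProb c N m ≤ ε := by
    by_cases hε0 : ε < r₀ / s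
    · obtain ⟨K₀, hK₀⟩ := exists_blockSize hua hub t c (ρ := r₀ / s - ε / 2) hε (by
        refine lt_of_lt_of_le ?_ (sum_le_sum fun k _ => hscale k (r₀ / s) (Or.inr le_rfl))
        rw [← mul_sum]
        exact hu1.trans_le (le_mul_of_one_le_right (by positivity) (hall (hε.trans hε0))))
      exact ⟨K₀, fun K hK hKK _ => hK₀ K hK hKK⟩
    · exact ⟨0, fun K hK _ h => absurd h hε0⟩
  have hKk : ∀ k, ∃ K₀ : ℕ, ∀ K (hK : 0 < K), K₀ ≤ K → ε < r k / s → ∀ N m : ℕ,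
      (((m / K : ℕ) : ℝ) + 1) * K ≤ (r k / s - ε / 2) * N →
      (twoAtomData K hK _ _ hua hub t).consistencyCode.errorProb (capacityOne w s k) N m ≤ ε := by
    intro k
    by_cases hε0 : ε < r k / s
    · obtain ⟨K₀, hK₀⟩ := exists_blockSize hua hub t (capacityOne w s k) (ρ := r k / s - ε / 2) hε (by
        have h1 : ∀ j : Fin d, j ≠ k → ((capacityOne w s k j : unitInterval) : ℝ) = 0 :=
          fun j hj => by simp [capacityOne, hj]
        have h2 : capacityOne w s k k = c k := if_pos rfl
        rw [Fintype.sum_eq_single k fun j hj => by rw [h1 j hj, zero_mul], h2]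
        refine lt_of_lt_of_le ?_ (hscale k (r k / s) (Or.inl (hρ1 k)))
        exact hu1.trans_le (le_mul_of_one_le_right (by positivity) (hone k (hε.trans hε0))))
      exact ⟨K₀, fun K hK hKK _ => hK₀ K hK hKK⟩
    · exact ⟨0, fun K hK _ h => absurd h hε0⟩
  obtain ⟨K₀, hK₀⟩ := hK0
  choose Kk hKk using hKk
  set K := max 1 (max K₀ (univ.sup Kk)) with hKdef
  have hK : 0 < K := lt_of_lt_of_le one_pos (le_max_left _ _)
  refine ⟨(twoAtomData K hK _ _ hua hub t).consistencyCode, ⟨_, _, _, rfl⟩, ?_, fun k => ?_⟩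
  · exact admissible_of_errorProb_le hε
      (hK₀ K hK ((le_max_left _ _).trans (le_max_right _ _)))
  · refine admissible_of_errorProb_le hε (hKk k K hK ?_)
    exact (le_sup (f := Kk) (mem_univ k)).trans ((le_max_right _ _).trans (le_max_right _ _))

end Region

end MultiRate

theorem mainTheorem2 (d : ℕ) (hd : 1 ≤ d) (w : Fin d → ℝ) (hw : ∀ k, 0 ≤ w k)
    (s : ℝ) (hs : 0 < s) (hws : ∀ k, w k ≤ s) :
    MultiRate.achievableRegion w s =
        {p : ℝ × (Fin d → ℝ) | 0 ≤ p.1 ∧ (∀ k, 0 ≤ p.2 k ∧ p.2 k ≤ w k) ∧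
          (p.1 ≤ ⨆ k, w k ∨ 1 ≤ ∑ k, (w k - p.2 k) / (p.1 - p.2 k))} ∧
      MultiRate.superpositionRegion w s = MultiRate.achievableRegion w s := by
  have : Nonempty (Fin d) := ⟨⟨0, hd⟩⟩
  have hbdd : BddAbove (Set.range w) := (Set.finite_range w).bddAbove
  have hconv : MultiRate.achievableRegion w s ⊆
      {p : ℝ × (Fin d → ℝ) | 0 ≤ p.1 ∧ (∀ k, 0 ≤ p.2 k ∧ p.2 k ≤ w k) ∧
        (p.1 ≤ ⨆ k, w k ∨ 1 ≤ ∑ k, (w k - p.2 k) / (p.1 - p.2 k))} := by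
    rintro ⟨r₀, r⟩ hp
    obtain ⟨h1, h2⟩ := MultiRate.bounds_of_mem_achievableRegion hd hw hs hws hp
    refine ⟨hp.1, fun k => ⟨hp.2.1 k, h1 k⟩, (le_or_gt r₀ (⨆ k, w k)).imp id fun h3 => ?_⟩
    exact h2 fun k => (le_ciSup hbdd k).trans_lt h3
  have hach : {p : ℝ × (Fin d → ℝ) | 0 ≤ p.1 ∧ (∀ k, 0 ≤ p.2 k ∧ p.2 k ≤ w k) ∧
        (p.1 ≤ ⨆ k, w k ∨ 1 ≤ ∑ k, (w k - p.2 k) / (p.1 - p.2 k))} ⊆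
      MultiRate.superpositionRegion w s := by
    rintro ⟨r₀, r⟩ ⟨h0, h1, h2⟩
    refine MultiRate.mem_superpositionRegion hw hs hws h0 (fun k => (h1 k).1) (fun k => (h1 k).2) ?_
    obtain ⟨k₀, hk₀⟩ := exists_eq_ciSup_of_finite (f := w)
    rcases le_or_gt r₀ (⨆ k, w k) with h3 | h3
    · exact Or.inl ⟨k₀, h3.trans_eq hk₀.symm⟩
    · exact Or.inr ⟨fun k => (le_ciSup hbdd k).trans_lt h3, h2.resolve_left (not_le.2 h3)⟩
  have hsub := MultiRate.superpositionRegion_subset w s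
  exact ⟨hconv.antisymm (hach.trans hsub), hsub.antisymm (hconv.trans hach)⟩
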